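/- Let $G$ be a finite-dimensional real Lie group with Lie algebra $\mathfrak g$, and write $g\cdot\eta\in T_gG$ for the left translate of $\eta\in\mathfrak g$. For a differentiable $F:G\to V$ with values in a finite-dimensional vector space let $D_gF:\mathfrak g\to V$ be the left-trivialized derivative, $D_gF\cdot\eta=\frac{d}{ds}\big|_{s=0}F(g\exp(s\eta))$ (that is, the derivative of $F$ at $g$ in the direction $g\cdot\eta$), and let $\mathrm{ad}_\xi\eta=[\xi,\eta]$. Let $N\ge 1$, $T_0\le T_N$, and let the mode functions $f_1,\dots,f_N:G\times\mathbb R\to\mathfrak g$ be $C^1$ on $G\times[T_0,T_N]$, let $L:G\to\mathbb R$ be $C^1$ and $\varphi:G\to\mathbb R$ differentiable, and let $g_0\in G$. For $\mathcal T=(T_1,\dots,T_{N-1})$ in the set $A=\{T_0\le T_1\le\dots\le T_{N-1}\le T_N\}$ put $$f(g,\mathcal T;t)=\sum_{k=1}^N\big[1(t-T_{k-1})-1(t-T_k)\big]f_k(g;t),$$ with $1(\cdot)$ the unit step function. A trajectory for $\mathcal T$ is a continuous curve $g$ on $[T_0,T_N]$ with $g(T_0)=g_0$ and $\dot g(t)=g(t)\cdot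 f(g(t),\mathcal T;t)$ for all $t\in[T_0,T_N]\setminus\{T_0,\dots,T_N\}$. Let $\mathcal T\in A$ have a trajectory $g$. Then every $\mathcal T'\in A$ sufficiently close to $\mathcal T$ has exactly one trajectory $g_{\mathcal T'}$, so that $$J(\mathcal T')=\int_{T_0}^{T_N}L(g_{\mathcal T'}(\tau))\,d\tau+\varphi(g_{\mathcal T'}(T_N))$$ is well defined for such $\mathcal T'$. There is a continuous costate $\rho:[T_0,T_N]\to\mathfrak g^*$ with $$\dot\rho(s)^T=-\rho(s)^T\big[D_gf(g(s),\mathcal T;s)-\mathrm{ad}_{f(g(s),\mathcal T;s)}\big]-D_gL(g(s))\quad\text{for all } s\in[T_0,T_N]\setminus\{T_0,\dots,T_N\},\qquad \rho(T_N)^T=D_g\varphi(g(T_N)).$$ For every such $\rho$, the function $J$ is differentiable at $\mathcal T$ relative to $A$, with gradient $\big(\frac{dJ}{dT_1},\dots,\frac{dJ}{dT_{N-1}}\big)$ given by $$\frac{dJ}{dT_i}=\rho(T_i)^T\big[f_i(g(T_i);T_i)-f_{i+1}(g(T_i);T_i)\big],\qquad i=1,\dots,N-1;$$ in particular these are the derivatives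 of $J$ with respect to the single times $T_i$ (one-sided where the constraints of $A$ allow $T_i$ to move to one side only). -/

import Mathlib

open scoped Manifold ContDiff Topology

noncomputable section

namespace LieSwitched

section

variable {E : Type*} [NormedAddCommGroup E] [NormedSpace ℝ E]
  {H : Type*} [TopologicalSpace H] (I : ModelWithCorners ℝ E H)
  {G : Type*} [TopologicalSpace G] [ChartedSpace H G] [Group G]

/-- The left-trivialized derivative `D_g F : 𝔤 → V` of a map `F : G → V` on a Lie group: the
derivative of `F` at `g` in the direction of the left translate `g · η` of `η ∈ 𝔤`. -/
def leftDeriv {V : Type*} [NormedAddCommGroup V] [NormedSpace ℝ V]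
    (F : G → V) (g : G) (η : GroupLieAlgebra I G) : V :=
  mfderiv I 𝓘(ℝ, V) F g (mulInvariantVectorField η g)

/-- For differentiable `F`, `leftDeriv I F g η` is the derivative at `s = 0` of `s ↦ F (g * c s)`
for every curve `c` through the identity with velocity `η`, in particular for `c s = exp (s η)`. -/
theorem hasDerivAt_leftDeriv [LieGroup I ∞ G] {V : Type*} [NormedAddCommGroup V]
    [NormedSpace ℝ V] {F : G → V} {g : G} (hF : MDifferentiableAt I 𝓘(ℝ, V) F g)
    {η : GroupLieAlgebra I G} {c : ℝ → G} (hc0 : c 0 = 1)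
    (hc : HasMFDerivAt 𝓘(ℝ, ℝ) I c 0
      ((1 : ℝ →L[ℝ] ℝ).smulRight (show TangentSpace I (c 0) from η))) :
    HasDerivAt (fun s => F (g * c s)) (leftDeriv I F g η) 0 := by
  let A : E →L[ℝ] E := mfderiv I I (fun x : G => g * x) 1
  let B : E →L[ℝ] V := mfderiv I 𝓘(ℝ, V) F g
  let C : ℝ →L[ℝ] E := (1 : ℝ →L[ℝ] ℝ).smulRight (show E from η)
  have hA : HasMFDerivAt I I (fun x : G => g * x) (c 0) A := by
    rw [hc0]
    exact ((contMDiff_mul_left (I := I) (n := ∞) (a := g)).mdifferentiableAt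
      (by simp)).hasMFDerivAt
  have hB : HasMFDerivAt I 𝓘(ℝ, V) F (g * c 0) B := by
    rw [hc0, mul_one]
    exact hF.hasMFDerivAt
  have key : HasFDerivAt (fun s : ℝ => F (g * c s)) (B.comp (A.comp C)) (0 : ℝ) :=
    (hB.comp (0 : ℝ) (hA.comp (0 : ℝ) hc)).hasFDerivAt
  have hval : (B.comp (A.comp C)) 1 = leftDeriv I F g η := by
    change B (A ((1 : ℝ) • (show E from η))) = B (A η)
    rw [one_smul]
  exact hval ▸ key.hasDerivAt

variable {I} in
/-- `leftDeriv` for maps with values in the Lie algebra `𝔤`, whose underlying normed space is `E`. -/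
def leftDerivLie (F : G → GroupLieAlgebra I G) (g : G) (η : GroupLieAlgebra I G) :
    GroupLieAlgebra I G :=
  leftDeriv (V := E) I F g η

/-- The unit step function. -/
def unitStep (t : ℝ) : ℝ := if 0 ≤ t then 1 else 0

/-- All the times `T_0, T_1, …, T_{n+1}`: the initial time `t₀`, the `n` transition times `T`, and
the final time `t₁`. -/
def times {n : ℕ} (t₀ t₁ : ℝ) (T : Fin n → ℝ) : Fin (n + 2) → ℝ :=
  Fin.cons (α := fun _ => ℝ) t₀ (Fin.snoc (α := fun _ => ℝ) T t₁)

/-- The vectors of transition times with `t₀ ≤ T_1 ≤ … ≤ T_n ≤ t₁`. -/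
def admissible (n : ℕ) (t₀ t₁ : ℝ) : Set (Fin n → ℝ) :=
  {T | Monotone (times t₀ t₁ T)}

variable {I} in
/-- The switched field `f(g, T; t) = ∑ₖ [1(t - T_{k-1}) - 1(t - T_k)] f_k(g; t)` with mode functions
`f_1, …, f_{n+1}` (here indexed from `0`). -/
def switchedField {n : ℕ} (f : Fin (n + 1) → G → ℝ → GroupLieAlgebra I G) (t₀ t₁ : ℝ)
    (T : Fin n → ℝ) (g : G) (t : ℝ) : GroupLieAlgebra I G :=
  ∑ k : Fin (n + 1),
    (unitStep (t - times t₀ t₁ T k.castSucc) - unitStep (t - times t₀ t₁ T k.succ)) • f k g t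

variable {I} in
/-- `γ` is a trajectory on `[t₀, t₁]`, starting at `g₀`, of the switched system
`γ' = γ · f(γ, T; t)`: it is continuous and solves the equation away from the times
`T_0, …, T_{n+1}`, where the field jumps. -/
structure IsTrajectory {n : ℕ} (f : Fin (n + 1) → G → ℝ → GroupLieAlgebra I G) (t₀ t₁ : ℝ) (g₀ : G)
    (T : Fin n → ℝ) (γ : ℝ → G) : Prop where
  init : γ t₀ = g₀
  continuousOn : ContinuousOn γ (Set.Icc t₀ t₁)
  ode : ∀ t ∈ Set.Icc t₀ t₁, t ∉ Set.range (times t₀ t₁ T) →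
    HasMFDerivAt 𝓘(ℝ, ℝ) I γ t ((1 : ℝ →L[ℝ] ℝ).smulRight
      (mulInvariantVectorField (switchedField f t₀ t₁ T (γ t) t) (γ t)))

/-- The cost `∫ L(γ(τ)) dτ + φ(γ(t₁))` of a curve `γ`. -/
def curveCost (t₀ t₁ : ℝ) (L φ : G → ℝ) (γ : ℝ → G) : ℝ :=
  (∫ τ in t₀..t₁, L (γ τ)) + φ (γ t₁)

open Classical in
variable {I} in
/-- The objective `J(T)`: the cost of the trajectory with transition times `T` starting at `g₀`
(and `0` if there is no such trajectory on `[t₀, t₁]`). -/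
def cost {n : ℕ} (f : Fin (n + 1) → G → ℝ → GroupLieAlgebra I G) (t₀ t₁ : ℝ) (g₀ : G)
    (L φ : G → ℝ) (T : Fin n → ℝ) : ℝ :=
  if h : ∃ γ : ℝ → G, IsTrajectory f t₀ t₁ g₀ T γ then curveCost t₀ t₁ L φ h.choose else 0

variable {I} in
/-- `ρ` is a costate along `γ`: a continuous curve in the dual of `𝔤` with
`ρ' = -ρ (D_g f - ad_f) - D_g L` away from the times `T_0, …, T_{n+1}` and `ρ(t₁) = D_g φ`.
The equations between covectors are evaluated at the vectors `η ∈ 𝔤`; `ad_f η = ⁅f, η⁆`. -/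
structure IsCostate {n : ℕ} (f : Fin (n + 1) → G → ℝ → GroupLieAlgebra I G) (t₀ t₁ : ℝ)
    (L φ : G → ℝ) (T : Fin n → ℝ) (γ : ℝ → G)
    (ρ : ℝ → Module.Dual ℝ (GroupLieAlgebra I G)) : Prop where
  terminal : ∀ η : GroupLieAlgebra I G, ρ t₁ η = leftDeriv I φ (γ t₁) η
  continuousOn : ∀ η : GroupLieAlgebra I G, ContinuousOn (fun s => ρ s η) (Set.Icc t₀ t₁)
  ode : ∀ s ∈ Set.Icc t₀ t₁, s ∉ Set.range (times t₀ t₁ T) → ∀ η : GroupLieAlgebra I G,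
    HasDerivAt (fun r => ρ r η)
      (-ρ s (leftDerivLie (fun g => switchedField f t₀ t₁ T g s) (γ s) η
          - ⁅switchedField f t₀ t₁ T (γ s) s, η⁆)
        - leftDeriv I L (γ s) η) s

end

end LieSwitched

end

/- Write a perturbed trajectory as `γ = g * locExp x`, where `locExp` is the recentred chart at the
identity. The deviation `x` vanishes at `t₀` and solves
`x' = leftFrame(x) f(γ, T'; t) - rightFrame(x) f(g, T; t)`, an equation on the fixed space `E` whose
field is Lipschitz in `x` and only integrable in `t`. At `x = 0` this field is supported between the
old and the new transition times, so its `L¹` norm is `O(‖T' - T‖)`, and Grönwall's inequality gives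
`‖x‖ = O(‖T' - T‖)`. Its linearization at `x = 0` is `D_g f - ad_f`, so the costate `p` solves the
adjoint equation, and integrating `(p x)'` gives
`J(T') - J(T) = ∫ p(s) F(T', s, 0) ds + o(‖T' - T‖)` with `F` the field. This integral is a sum of
integrals of continuous functions between consecutive transition times, hence explicitly
differentiable in `T'`. -/

noncomputable section

namespace LieSwitched

open Set Filter MeasureTheory Metric Function

theorem mapsTo_of_confined {X : Type*} [TopologicalSpace X] {a b : ℝ} {h : ℝ → X} {K W : Set X}
    (hh : ContinuousOn h (Icc a b)) (hK : IsClosed K) (hW : IsOpen W) (hKW : K ⊆ W) (ha : h a ∈ K)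
    (hconf : ∀ c ∈ Icc a b, MapsTo h (Icc a c) W → h c ∈ K) : MapsTo h (Icc a b) K := by
  refine IsClosed.Icc_subset_of_forall_mem_nhdsGT_of_Icc_subset (s := h ⁻¹' K) ?_ ha
    fun t ht htK => ?_
  · rw [inter_comm]
    exact hh.preimage_isClosed_of_isClosed isClosed_Icc hK
  · have hWt : h ⁻¹' W ∈ 𝓝[Icc t b] t :=
      nhdsWithin_mono t (Icc_subset_Icc_left ht.1)
        (hh t ⟨ht.1, ht.2.le⟩ (hW.mem_nhds (hKW (htK (right_mem_Icc.2 ht.1)))))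
    rw [nhdsWithin_Icc_eq_nhdsGE ht.2] at hWt
    obtain ⟨c, hc, hcW⟩ := (mem_nhdsGE_iff_exists_Ico_subset' ht.2).1 hWt
    filter_upwards [Ioo_mem_nhdsGT (lt_min hc ht.2)] with s hs
    obtain ⟨hsc, hsb⟩ := lt_min_iff.1 hs.2
    refine hconf s ⟨ht.1.trans hs.1.le, hsb.le⟩ fun σ hσ => ?_
    rcases le_or_gt σ t with h | h
    · exact hKW (htK ⟨hσ.1, h⟩)
    · exact hcW ⟨h.le, hσ.2.trans_lt hsc⟩

theorem hasDerivAt_of_eventually_hasDerivAt_of_ne {E : Type*} [NormedAddCommGroup E]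
    [NormedSpace ℝ E] {f g : ℝ → E} {t : ℝ} (hd : ∀ᶠ s in 𝓝[≠] t, HasDerivAt f (g s) s)
    (hf : ContinuousAt f t) (hg : ContinuousAt g t) : HasDerivAt f (g t) t := by
  rw [← nhdsLT_sup_nhdsGT, eventually_sup] at hd
  have hright : HasDerivWithinAt f (g t) (Ici t) t :=
    hasDerivWithinAt_Ici_of_tendsto_deriv
      (fun s (hs : HasDerivAt f (g s) s) => hs.differentiableAt.differentiableWithinAt)
      hf.continuousWithinAt hd.2
      ((hg.mono_left inf_le_left).congr' (hd.2.mono fun s hs => hs.deriv.symm))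
  have hleft : HasDerivWithinAt f (g t) (Iic t) t :=
    hasDerivWithinAt_Iic_of_tendsto_deriv
      (fun s (hs : HasDerivAt f (g s) s) => hs.differentiableAt.differentiableWithinAt)
      hf.continuousWithinAt hd.1
      ((hg.mono_left inf_le_left).congr' (hd.1.mono fun s hs => hs.deriv.symm))
  simpa using hright.union hleft

theorem fderiv_comp_clm_comp_clm_zero {E F V : Type*} [NormedAddCommGroup E] [NormedSpace ℝ E]
    [NormedAddCommGroup F] [NormedSpace ℝ F] [NormedAddCommGroup V] [NormedSpace ℝ V]
    {Φ : F → F →L[ℝ] V} (hΦ : DifferentiableAt ℝ Φ 0) (ι κ : E →L[ℝ] F) (v w : E) :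
    fderiv ℝ (fun x => Φ (ι x) ∘L κ) 0 v w = fderiv ℝ Φ 0 (ι v) (κ w) := by
  have hΦ' : HasFDerivAt Φ (fderiv ℝ Φ 0) (ι 0) := by simpa using hΦ.hasFDerivAt
  have h := (hΦ'.comp (0 : E) ι.hasFDerivAt).clm_comp (hasFDerivAt_const κ (0 : E))
  simp only [comp_def] at h
  simp [h.fderiv]

theorem hasDerivAt_clm_apply {E F : Type*} [NormedAddCommGroup E] [NormedSpace ℝ E]
    [FiniteDimensional ℝ E] [NormedAddCommGroup F] [NormedSpace ℝ F] {p : ℝ → E →L[ℝ] F}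
    {p' : E →L[ℝ] F} {s : ℝ} :
    HasDerivAt p p' s ↔ ∀ v, HasDerivAt (fun r => p r v) (p' v) s := by
  have hupdate : ∀ v, (fun r => update (slope p s) s p' r v)
      = update (slope (fun r => p r v) s) s (p' v) := fun v => by
    ext r
    rcases eq_or_ne r s with rfl | hr
    · simp
    · simp [hr, slope]
  simp only [hasDerivAt_iff_tendsto_slope, ← continuousAt_update_same, continuousAt_clm_apply,
    hupdate]

theorem hasDerivWithinAt_comp_update {n : ℕ} {V : Type*} [NormedAddCommGroup V] [NormedSpace ℝ V]
    {J : (Fin n → ℝ) → V} {J' : (Fin n → ℝ) →L[ℝ] V} {S : Set (Fin n → ℝ)} {T : Fin n → ℝ}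
    (h : HasFDerivWithinAt J J' S T) (i : Fin n) :
    HasDerivWithinAt (fun s => J (update T i s)) (J' (Pi.single i 1)) {s | update T i s ∈ S}
      (T i) :=
  HasFDerivWithinAt.comp_hasDerivWithinAt (T i) ((update_eq_self i T).symm ▸ h)
    (hasDerivAt_update T i (T i)).hasDerivWithinAt fun _ hs => hs

theorem contMDiffOn_clm_apply_snd {E E' F F' : Type*} [NormedAddCommGroup E] [NormedSpace ℝ E]
    [NormedAddCommGroup E'] [NormedSpace ℝ E'] [NormedAddCommGroup F] [NormedSpace ℝ F]
    [NormedAddCommGroup F'] [NormedSpace ℝ F'] {H' : Type*} [TopologicalSpace H']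
    {J : ModelWithCorners ℝ E' H'} {N : Type*} [TopologicalSpace N] [ChartedSpace H' N]
    {S : Set N} {U : Set E} {A : E → F →L[ℝ] F'} {Ψ : N × E → F} (hA : ContDiffOn ℝ 1 A U)
    (hΨ : ContMDiffOn (J.prod 𝓘(ℝ, E)) 𝓘(ℝ, F) 1 Ψ (S ×ˢ U)) :
    ContMDiffOn (J.prod 𝓘(ℝ, E)) 𝓘(ℝ, F') 1 (fun p => A p.2 (Ψ p)) (S ×ˢ U) :=
  (hA.contMDiffOn.comp contMDiff_snd.contMDiffOn fun _ hp => hp.2).clm_apply hΨ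

section IntegralEquations

variable {E : Type*} [NormedAddCommGroup E] {a b : ℝ}

theorem intervalIntegrable_left_of_mem_Icc {u : ℝ → E} {c : ℝ}
    (hu : IntervalIntegrable u volume a b) (hc : c ∈ Icc a b) : IntervalIntegrable u volume a c :=
  hu.mono_set (uIcc_subset_uIcc_left (Icc_subset_uIcc hc))

theorem exists_continuous_eqOn_Icc (hab : a ≤ b) {u : ℝ → E} (hu : ContinuousOn u (Icc a b)) :
    ∃ v : ℝ → E, Continuous v ∧ EqOn v u (Icc a b) :=
  ⟨IccExtend hab ((Icc a b).domRestrict u),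
    (continuousOn_iff_continuous_domRestrict.1 hu).Icc_extend',
    fun s hs => by simp [IccExtend_of_mem hab _ hs]⟩

/-- A field on the closed ball of radius `r` satisfying the Carathéodory conditions on `[a, b]`: it
is Lipschitz in space, and only integrable in time, along continuous curves. -/
structure IsCaratheodory (F : ℝ → E → E) (a b r : ℝ) (K : NNReal) : Prop where
  le : a ≤ b
  radius_nonneg : 0 ≤ r
  lipschitz : ∀ t ∈ Icc a b, LipschitzOnWith K (F t) (closedBall 0 r)
  intervalIntegrable : ∀ x : ℝ → E, ContinuousOn x (Icc a b) →
    MapsTo x (Icc a b) (closedBall 0 r) → IntervalIntegrable (fun s => F s (x s)) volume a b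

/-- The curves on `[a, b]` satisfying the a priori bound `‖x t‖ ≤ M * exp (K * (t - a))` for
solutions; the Picard iteration takes place in this set. -/
def gronwallSet (E : Type*) [NormedAddCommGroup E] (a b M K : ℝ) : Set C(Icc a b, E) :=
  {y | ∀ t, ‖y t‖ ≤ M * Real.exp (K * (t - a))}

theorem isClosed_gronwallSet (a b M K : ℝ) : IsClosed (gronwallSet E a b M K) := by
  simp only [gronwallSet, ofPred_forall]
  exact isClosed_iInter fun t => isClosed_le (by fun_prop) continuous_const

namespace IsCaratheodory

variable {F : ℝ → E → E} {r M : ℝ} {K : NNReal} {x y : ℝ → E}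

theorem zero_mem (h : IsCaratheodory F a b r K) : (0 : E) ∈ closedBall (0 : E) r :=
  mem_closedBall_self h.radius_nonneg

theorem intervalIntegrable_zero (h : IsCaratheodory F a b r K) :
    IntervalIntegrable (fun s => F s 0) volume a b :=
  h.intervalIntegrable _ continuousOn_const fun _ _ => h.zero_mem

theorem norm_sub_le (h : IsCaratheodory F a b r K) {t : ℝ} (ht : t ∈ Icc a b) {x y : E}
    (hx : x ∈ closedBall 0 r) (hy : y ∈ closedBall 0 r) : ‖F t x - F t y‖ ≤ K * ‖x - y‖ := by
  simpa only [dist_eq_norm] using (h.lipschitz t ht).dist_le_mul x hx y hy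

theorem norm_le (h : IsCaratheodory F a b r K) {t : ℝ} (ht : t ∈ Icc a b) {x : E}
    (hx : x ∈ closedBall 0 r) : ‖F t x‖ ≤ ‖F t 0‖ + K * ‖x‖ := by
  have := h.norm_sub_le ht hx h.zero_mem
  rw [sub_zero] at this
  exact (norm_le_norm_add_norm_sub' _ _).trans (add_le_add_right this _)

theorem mono (h : IsCaratheodory F a b r K) {c : ℝ} (hc : c ∈ Icc a b) :
    IsCaratheodory F a c r K where
  le := hc.1
  radius_nonneg := h.radius_nonneg
  lipschitz t ht := h.lipschitz t ⟨ht.1, ht.2.trans hc.2⟩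
  intervalIntegrable x hx hxr := by
    have hmaps : MapsTo (fun s => min s c) (Icc a b) (Icc a c) := fun s hs =>
      ⟨le_min hs.1 hc.1, min_le_right _ _⟩
    have hext := intervalIntegrable_left_of_mem_Icc (h.intervalIntegrable (fun s => x (min s c))
      (hx.comp (by fun_prop) hmaps) (hxr.comp hmaps)) hc
    refine hext.congr fun s hs => ?_
    rw [uIoc_of_le hc.1] at hs
    simp only [min_eq_left hs.2]

theorem mapsTo_IccExtend (h : IsCaratheodory F a b r K) (hMr : M * Real.exp (K * (b - a)) ≤ r)
    (y : gronwallSet E a b M K) : MapsTo (IccExtend h.le y.1) (Icc a b) (closedBall 0 r) := by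
  intro s hs
  have hM : 0 ≤ M := by simpa using (norm_nonneg _).trans (y.2 ⟨a, left_mem_Icc.2 h.le⟩)
  rw [IccExtend_of_mem h.le _ hs, mem_closedBall_zero_iff]
  refine (y.2 ⟨s, hs⟩).trans (le_trans ?_ hMr)
  have := hs.2
  gcongr

end IsCaratheodory

variable [NormedSpace ℝ E]

theorem integral_congr_Icc (hab : a ≤ b) {u v : ℝ → E} (h : EqOn u v (Icc a b)) :
    ∫ s in a..b, u s = ∫ s in a..b, v s :=
  intervalIntegral.integral_congr (by rwa [uIcc_of_le hab])

theorem hasDerivAt_of_eq_add_integral [CompleteSpace E] {x v : ℝ → E} {x₀ : E}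
    (hv : IntervalIntegrable v volume a b) (hx : ∀ t ∈ Icc a b, x t = x₀ + ∫ s in a..t, v s)
    {t : ℝ} (ht : t ∈ Ioo a b) (hvt : ContinuousAt v t) : HasDerivAt x (v t) t := by
  have hmem : Ioo a b ∈ 𝓝 t := Ioo_mem_nhds ht.1 ht.2
  have hmeas : StronglyMeasurableAtFilter v (𝓝 t) :=
    ⟨Ioc a b, mem_of_superset hmem Ioo_subset_Ioc_self, hv.aestronglyMeasurable⟩
  have hint := intervalIntegrable_left_of_mem_Icc hv (Ioo_subset_Icc_self ht)
  refine ((intervalIntegral.integral_hasDerivAt_right hint hmeas hvt).const_add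
    x₀).congr_of_eventuallyEq ?_
  filter_upwards [hmem] with s hs using hx s (Ioo_subset_Icc_self hs)

theorem le_mul_exp_of_le_add_integral {u : ℝ → ℝ} {c K : ℝ} (hK : 0 ≤ K)
    (hu : ContinuousOn u (Icc a b)) (h : ∀ t ∈ Icc a b, u t ≤ c + K * ∫ s in a..t, u s)
    {t : ℝ} (ht : t ∈ Icc a b) : u t ≤ c * Real.exp (K * (t - a)) := by
  obtain ⟨v, hv, hvu⟩ := exists_continuous_eqOn_Icc (ht.1.trans ht.2) hu
  have hint : ∀ s ∈ Icc a b, ∫ τ in a..s, v τ = ∫ τ in a..s, u τ := fun s hs =>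
    integral_congr_Icc hs.1 (hvu.mono (Icc_subset_Icc_right hs.2))
  have hd : ∀ s, HasDerivAt (fun s => c + K * ∫ τ in a..s, v τ) (K * v s) s := fun s =>
    ((hv.integral_hasStrictDerivAt a s).hasDerivAt.const_mul K).const_add c
  have bound := le_gronwallBound_of_liminf_deriv_right_le (δ := c) (K := K) (ε := 0)
    (fun s _ => (hd s).continuousAt.continuousWithinAt)
    (fun s _ r hr => (hd s).hasDerivWithinAt.liminf_right_slope_le hr) (by simp)
    (fun s hs => by
      rw [add_zero, hvu (Ico_subset_Icc_self hs), hint s (Ico_subset_Icc_self hs)]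
      exact mul_le_mul_of_nonneg_left (h s (Ico_subset_Icc_self hs)) hK) t ht
  rw [gronwallBound_ε0, hint t ht] at bound
  exact (h t ht).trans bound

theorem mul_integral_mul_exp (M K a t : ℝ) :
    K * ∫ s in a..t, M * Real.exp (K * (s - a)) = M * Real.exp (K * (t - a)) - M := by
  have hd : ∀ s, HasDerivAt (fun s => M * Real.exp (K * (s - a)))
      (K * (M * Real.exp (K * (s - a)))) s := fun s => by
    convert! ((((hasDerivAt_id s).sub_const a).const_mul K).exp).const_mul M using 1
    simp only [id]; ring
  rw [← intervalIntegral.integral_const_mul, intervalIntegral.integral_eq_sub_of_hasDerivAt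
    (fun s _ => hd s) (Continuous.intervalIntegrable (by fun_prop) _ _)]
  simp

/-- A solution in the closed ball of radius `r`, in the sense of Carathéodory, of the initial value
problem `x' = F(t, x)`, `x(a) = 0`. -/
structure IsCaratheodorySolution (F : ℝ → E → E) (a b r : ℝ) (x : ℝ → E) : Prop where
  continuousOn : ContinuousOn x (Icc a b)
  mapsTo : MapsTo x (Icc a b) (closedBall 0 r)
  eq_integral : ∀ t ∈ Icc a b, x t = ∫ s in a..t, F s (x s)

namespace IsCaratheodory

variable {F : ℝ → E → E} {r : ℝ} {K : NNReal} {x y : ℝ → E}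

theorem norm_integral_le (h : IsCaratheodory F a b r K) (hx : ContinuousOn x (Icc a b))
    (hxr : MapsTo x (Icc a b) (closedBall 0 r)) {t : ℝ} (ht : t ∈ Icc a b) :
    ‖∫ s in a..t, F s (x s)‖ ≤ (∫ s in a..b, ‖F s 0‖) + K * ∫ s in a..t, ‖x s‖ := by
  have hF := h.intervalIntegrable_zero.norm
  have hFt := intervalIntegrable_left_of_mem_Icc hF ht
  have hxt : IntervalIntegrable (fun s => K * ‖x s‖) volume a t :=
    ((hx.norm.mono (Icc_subset_Icc_right ht.2)).intervalIntegrable_of_Icc ht.1).const_mul _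
  calc ‖∫ s in a..t, F s (x s)‖
      ≤ ∫ s in a..t, (‖F s 0‖ + K * ‖x s‖) :=
        intervalIntegral.norm_integral_le_of_norm_le ht.1 (ae_of_all _ fun s hs =>
          have hs' : s ∈ Icc a b := ⟨hs.1.le, hs.2.trans ht.2⟩
          h.norm_le hs' (hxr hs')) (hFt.add hxt)
    _ = (∫ s in a..t, ‖F s 0‖) + K * ∫ s in a..t, ‖x s‖ := by
        rw [intervalIntegral.integral_add hFt hxt, intervalIntegral.integral_const_mul]
    _ ≤ (∫ s in a..b, ‖F s 0‖) + K * ∫ s in a..t, ‖x s‖ := by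
        gcongr
        exact intervalIntegral.integral_mono_interval le_rfl ht.1 ht.2
          (ae_of_all _ fun s => norm_nonneg _) hF

theorem norm_solution_le (h : IsCaratheodory F a b r K) (hx : IsCaratheodorySolution F a b r x)
    {t : ℝ} (ht : t ∈ Icc a b) :
    ‖x t‖ ≤ (∫ s in a..b, ‖F s 0‖) * Real.exp (K * (t - a)) :=
  le_mul_exp_of_le_add_integral K.coe_nonneg hx.continuousOn.norm (fun s hs => by
    rw [hx.eq_integral s hs]
    exact h.norm_integral_le hx.continuousOn hx.mapsTo hs) ht

theorem eqOn_solution (h : IsCaratheodory F a b r K) (hx : IsCaratheodorySolution F a b r x)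
    (hy : IsCaratheodorySolution F a b r y) : EqOn x y (Icc a b) := by
  intro t ht
  have hc : ContinuousOn (fun s => ‖x s - y s‖) (Icc a b) :=
    (hx.continuousOn.sub hy.continuousOn).norm
  have hle : ‖x t - y t‖ ≤ 0 * Real.exp (K * (t - a)) :=
    le_mul_exp_of_le_add_integral K.coe_nonneg hc (fun c hc' => ?_) ht
  · rwa [zero_mul, norm_le_zero_iff, sub_eq_zero] at hle
  · have hint := fun {z} (hz : IsCaratheodorySolution F a b r z) =>
      intervalIntegrable_left_of_mem_Icc (h.intervalIntegrable z hz.continuousOn hz.mapsTo) hc'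
    rw [hx.eq_integral c hc', hy.eq_integral c hc', zero_add,
      ← intervalIntegral.integral_sub (hint hx) (hint hy), ← intervalIntegral.integral_const_mul]
    refine intervalIntegral.norm_integral_le_of_norm_le hc'.1 (ae_of_all _ fun s hs => ?_)
      (((hc.mono (Icc_subset_Icc_right hc'.2)).intervalIntegrable_of_Icc hc'.1).const_mul _)
    have hs' : s ∈ Icc a b := ⟨hs.1.le, hs.2.trans hc'.2⟩
    exact h.norm_sub_le hs' (hx.mapsTo hs') (hy.mapsTo hs')

theorem hasDerivAt_solution [CompleteSpace E] (h : IsCaratheodory F a b r K)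
    (hx : IsCaratheodorySolution F a b r x) {t : ℝ} (ht : t ∈ Ioo a b)
    (hF : ContinuousAt (fun s => F s (x s)) t) : HasDerivAt x (F t (x t)) t :=
  hasDerivAt_of_eq_add_integral (x₀ := 0) (h.intervalIntegrable x hx.continuousOn hx.mapsTo)
    (fun s hs => by rw [zero_add, hx.eq_integral s hs]) ht hF

theorem continuous_integral (h : IsCaratheodory F a b r K) (hx : ContinuousOn x (Icc a b))
    (hxr : MapsTo x (Icc a b) (closedBall 0 r)) :
    Continuous fun t : Icc a b => ∫ s in a..(t : ℝ), F s (x s) := by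
  have hc := intervalIntegral.continuousOn_primitive_interval'
    (h.intervalIntegrable x hx hxr) left_mem_uIcc
  rw [uIcc_of_le h.le] at hc
  exact continuousOn_iff_continuous_domRestrict.1 hc

theorem norm_integral_comp_le_of_mem_gronwallSet (h : IsCaratheodory F a b r K)
    (hMr : (∫ s in a..b, ‖F s 0‖) * Real.exp (K * (b - a)) ≤ r)
    (y : gronwallSet E a b (∫ s in a..b, ‖F s 0‖) K) (t : Icc a b) :
    ‖∫ s in a..t, F s (IccExtend h.le y.1 s)‖
      ≤ (∫ s in a..b, ‖F s 0‖) * Real.exp (K * (t - a)) := by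
  have hy : Continuous (IccExtend h.le y.1) := y.1.continuous.Icc_extend'
  calc ‖∫ s in a..t, F s (IccExtend h.le y.1 s)‖
      ≤ (∫ s in a..b, ‖F s 0‖) + K * ∫ s in a..t, ‖IccExtend h.le y.1 s‖ :=
        h.norm_integral_le hy.continuousOn (h.mapsTo_IccExtend hMr y) t.2
    _ ≤ (∫ s in a..b, ‖F s 0‖)
          + K * ∫ s in a..t, (∫ s in a..b, ‖F s 0‖) * Real.exp (K * (s - a)) := by
        gcongr
        refine intervalIntegral.integral_mono_on t.2.1 (hy.norm.intervalIntegrable _ _)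
          (Continuous.intervalIntegrable (by fun_prop) _ _) fun s hs => ?_
        have hs' : s ∈ Icc a b := ⟨hs.1, hs.2.trans t.2.2⟩
        rw [IccExtend_of_mem h.le _ hs']
        exact y.2 ⟨s, hs'⟩
    _ = (∫ s in a..b, ‖F s 0‖) * Real.exp (K * (t - a)) := by rw [mul_integral_mul_exp]; ring

/-- The Picard operator `x ↦ ∫ₐ F(s, x(s)) ds`, for fields so small at `0` that it preserves the a
priori bound. -/
def picard (h : IsCaratheodory F a b r K)
    (hMr : (∫ s in a..b, ‖F s 0‖) * Real.exp (K * (b - a)) ≤ r)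
    (y : gronwallSet E a b (∫ s in a..b, ‖F s 0‖) K) :
    gronwallSet E a b (∫ s in a..b, ‖F s 0‖) K :=
  ⟨⟨fun t => ∫ s in a..t, F s (IccExtend h.le y.1 s), h.continuous_integral
    y.1.continuous.Icc_extend'.continuousOn (h.mapsTo_IccExtend hMr y)⟩,
    h.norm_integral_comp_le_of_mem_gronwallSet hMr y⟩

theorem norm_picard_sub_le (h : IsCaratheodory F a b r K)
    (hMr : (∫ s in a..b, ‖F s 0‖) * Real.exp (K * (b - a)) ≤ r)
    {y z : gronwallSet E a b (∫ s in a..b, ‖F s 0‖) K} {C : ℝ} {n : ℕ}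
    (hyz : ∀ t : Icc a b, ‖y.1 t - z.1 t‖ ≤ C * (t - a) ^ n) (t : Icc a b) :
    ‖(h.picard hMr y).1 t - (h.picard hMr z).1 t‖ ≤ K * C * ((t - a) ^ (n + 1) / (n + 1)) := by
  have hint := fun w => intervalIntegrable_left_of_mem_Icc (h.intervalIntegrable _
    w.1.continuous.Icc_extend'.continuousOn (h.mapsTo_IccExtend hMr w)) t.2
  have bound : ∀ s ∈ Ioc a (t : ℝ),
      ‖F s (IccExtend h.le y.1 s) - F s (IccExtend h.le z.1 s)‖ ≤ K * C * (s - a) ^ n :=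
    fun s hs => by
      have hs' : s ∈ Icc a b := ⟨hs.1.le, hs.2.trans t.2.2⟩
      refine (h.norm_sub_le hs' (h.mapsTo_IccExtend hMr y hs')
        (h.mapsTo_IccExtend hMr z hs')).trans ?_
      rw [IccExtend_of_mem h.le _ hs', IccExtend_of_mem h.le _ hs', mul_assoc]
      exact mul_le_mul_of_nonneg_left (hyz ⟨s, hs'⟩) K.coe_nonneg
  calc ‖(h.picard hMr y).1 t - (h.picard hMr z).1 t‖
      = ‖∫ s in a..t, (F s (IccExtend h.le y.1 s) - F s (IccExtend h.le z.1 s))‖ := by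
        rw [intervalIntegral.integral_sub (hint y) (hint z)]; rfl
    _ ≤ ∫ s in a..t, K * C * (s - a) ^ n :=
        intervalIntegral.norm_integral_le_of_norm_le t.2.1 (ae_of_all _ bound)
          (Continuous.intervalIntegrable (by fun_prop) _ _)
    _ = K * C * ((t - a) ^ (n + 1) / (n + 1)) := by
        rw [intervalIntegral.integral_const_mul,
          intervalIntegral.integral_comp_sub_right (fun s => s ^ n), integral_pow, sub_self,
          zero_pow n.succ_ne_zero, sub_zero]

theorem norm_picard_iterate_sub_le (h : IsCaratheodory F a b r K)
    (hMr : (∫ s in a..b, ‖F s 0‖) * Real.exp (K * (b - a)) ≤ r) (n : ℕ)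
    (y z : gronwallSet E a b (∫ s in a..b, ‖F s 0‖) K) (t : Icc a b) :
    ‖((h.picard hMr)^[n] y).1 t - ((h.picard hMr)^[n] z).1 t‖
      ≤ K ^ n / n.factorial * dist y z * (t - a) ^ n := by
  induction n generalizing t with
  | zero =>
    simpa [← dist_eq_norm, Subtype.dist_eq] using
      ContinuousMap.dist_apply_le_dist (f := y.1) (g := z.1) t
  | succ n ih =>
    rw [iterate_succ_apply', iterate_succ_apply']
    refine (h.norm_picard_sub_le hMr ih t).trans_eq ?_
    rw [Nat.factorial_succ]
    push_cast
    field_simp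
    ring

theorem exists_contractingWith_picard_iterate (h : IsCaratheodory F a b r K)
    (hMr : (∫ s in a..b, ‖F s 0‖) * Real.exp (K * (b - a)) ≤ r) :
    ∃ (n : ℕ) (q : NNReal), ContractingWith q (h.picard hMr)^[n] := by
  obtain ⟨n, hn⟩ := ((FloorSemiring.tendsto_pow_div_factorial_atTop (K * (b - a))).eventually
    (gt_mem_nhds zero_lt_one)).exists
  have hab := sub_nonneg.2 h.le
  lift (K * (b - a)) ^ n / (n.factorial : ℝ) to NNReal using by positivity with q hq
  refine ⟨n, q, by exact_mod_cast hn, LipschitzWith.of_dist_le_mul fun y z => ?_⟩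
  rw [Subtype.dist_eq, ContinuousMap.dist_le (by positivity)]
  intro t
  rw [dist_eq_norm, hq]
  have h₁ := sub_nonneg.2 t.2.1
  have h₂ := t.2.2
  calc _ ≤ K ^ n / n.factorial * dist y z * (t - a) ^ n :=
        h.norm_picard_iterate_sub_le hMr n y z t
    _ ≤ K ^ n / n.factorial * dist y z * (b - a) ^ n := by gcongr
    _ = (K * (b - a)) ^ n / n.factorial * dist y z := by rw [mul_pow]; ring

theorem exists_solution [CompleteSpace E] (h : IsCaratheodory F a b r K)
    (hMr : (∫ s in a..b, ‖F s 0‖) * Real.exp (K * (b - a)) ≤ r) :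
    ∃ x, IsCaratheodorySolution F a b r x := by
  obtain ⟨n, q, hq⟩ := h.exists_contractingWith_picard_iterate hMr
  have : CompleteSpace (gronwallSet E a b (∫ s in a..b, ‖F s 0‖) K) :=
    (isClosed_gronwallSet _ _ _ _).completeSpace_coe
  have : Nonempty (gronwallSet E a b (∫ s in a..b, ‖F s 0‖) K) := ⟨0, fun t => by
    have := intervalIntegral.integral_nonneg (μ := volume) (f := fun s => ‖F s 0‖) h.le
      fun _ _ => norm_nonneg _
    simp only [ContinuousMap.zero_apply, norm_zero]
    positivity⟩
  have hfix := hq.isFixedPt_fixedPoint_iterate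
  set y := ContractingWith.fixedPoint _ hq
  refine ⟨IccExtend h.le y.1, y.1.continuous.Icc_extend'.continuousOn, h.mapsTo_IccExtend hMr y,
    fun t ht => ?_⟩
  rw [IccExtend_of_mem h.le _ ht]
  exact congrArg (fun w => w.1 ⟨t, ht⟩) hfix.eq.symm

end IsCaratheodory

theorem intervalIntegrable_bilin_of_continuousOn {F G : Type*} [NormedAddCommGroup F]
    [NormedSpace ℝ F] [NormedAddCommGroup G] [NormedSpace ℝ G] (B : E →L[ℝ] F →L[ℝ] G)
    (hab : a ≤ b) {u : ℝ → E} {v : ℝ → F} (hu : IntervalIntegrable u volume a b)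
    (hv : ContinuousOn v (Icc a b)) : IntervalIntegrable (fun s => B (u s) (v s)) volume a b := by
  obtain ⟨C, hC⟩ := isCompact_Icc.exists_bound_of_continuousOn hv
  rw [intervalIntegrable_iff_integrableOn_Icc_of_le hab] at hu ⊢
  exact B.integrable_of_bilin_of_bdd_right C hu (hv.aestronglyMeasurable measurableSet_Icc)
    (ae_restrict_of_forall_mem measurableSet_Icc hC)

theorem intervalIntegrable_clm_apply_of_continuousOn {F : Type*} [NormedAddCommGroup F]
    [NormedSpace ℝ F] (hab : a ≤ b) {A : ℝ → E →L[ℝ] F} {v : ℝ → E}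
    (hA : IntervalIntegrable A volume a b) (hv : ContinuousOn v (Icc a b)) :
    IntervalIntegrable (fun s => A s (v s)) volume a b :=
  intervalIntegrable_bilin_of_continuousOn (.id ℝ _) hab hA hv

theorem isCaratheodory_affine {A : ℝ → E →L[ℝ] E} {v : ℝ → E} {r : ℝ} {K : NNReal} (hab : a ≤ b)
    (hr : 0 ≤ r) (hA : IntervalIntegrable A volume a b) (hAK : ∀ t ∈ Icc a b, ‖A t‖₊ ≤ K)
    (hv : IntervalIntegrable v volume a b) : IsCaratheodory (fun t y => A t y + v t) a b r K where
  le := hab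
  radius_nonneg := hr
  lipschitz t ht := (LipschitzWith.of_dist_le_mul fun x y => by
    rw [dist_add_right]
    exact ((A t).dist_le_opNorm x y).trans (mul_le_mul_of_nonneg_right (hAK t ht) dist_nonneg)
    ).lipschitzOnWith
  intervalIntegrable x hx _ := (intervalIntegrable_clm_apply_of_continuousOn hab hA hx).add hv

theorem exists_eq_add_integral_of_affine [CompleteSpace E] {A : ℝ → E →L[ℝ] E} {v : ℝ → E}
    {K : NNReal} (hab : a ≤ b) (hA : IntervalIntegrable A volume a b)
    (hAK : ∀ t ∈ Icc a b, ‖A t‖₊ ≤ K) (hv : IntervalIntegrable v volume a b) (x₀ : E) :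
    ∃ x : ℝ → E, ContinuousOn x (Icc a b) ∧
      ∀ t ∈ Icc a b, x t = x₀ + ∫ s in a..t, (A s (x s) + v s) := by
  have hv' : IntervalIntegrable (fun s => A s x₀ + v s) volume a b :=
    (intervalIntegrable_clm_apply_of_continuousOn hab hA continuousOn_const).add hv
  have hr : 0 ≤ (∫ s in a..b, ‖A s 0 + (A s x₀ + v s)‖) * Real.exp (K * (b - a)) :=
    mul_nonneg (intervalIntegral.integral_nonneg hab fun _ _ => norm_nonneg _) (Real.exp_pos _).le
  obtain ⟨x, hx⟩ := (isCaratheodory_affine hab hr hA hAK hv').exists_solution le_rfl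
  refine ⟨fun t => x₀ + x t, continuousOn_const.add hx.continuousOn, fun t ht => ?_⟩
  simp only [hx.eq_integral t ht, map_add, add_assoc, add_left_comm]

end IntegralEquations

theorem IsCaratheodory.isCaratheodorySolution_of_hasDerivAt {E : Type*} [NormedAddCommGroup E]
    [NormedSpace ℝ E] [CompleteSpace E] {F : ℝ → E → E} {a b r : ℝ} {K : NNReal} {x : ℝ → E}
    (hF : IsCaratheodory F a b r K) (hx : ContinuousOn x (Icc a b))
    (hxr : MapsTo x (Icc a b) (closedBall 0 r)) (hxa : x a = 0) {S : Set ℝ} (hS : S.Countable)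
    (hd : ∀ t ∈ Ioo a b, t ∉ S → HasDerivAt x (F t (x t)) t) :
    IsCaratheodorySolution F a b r x := by
  refine ⟨hx, hxr, fun t ht => ?_⟩
  have hsub : Icc a t ⊆ Icc a b := Icc_subset_Icc_right ht.2
  rw [integral_eq_of_hasDerivAt_off_countable_of_le x _ ht.1 hS (hx.mono hsub)
    (fun s hs => hd s (Ioo_subset_Ioo_right ht.2 hs.1) hs.2)
    ((hF.mono ht).intervalIntegrable x (hx.mono hsub) (hxr.mono_left hsub)), hxa, sub_zero]

section Adjoint

variable {E V : Type*} [NormedAddCommGroup E] [NormedSpace ℝ E] [NormedAddCommGroup V]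
  [NormedSpace ℝ V] {a b r : ℝ}

/-- A map on `[a, b]` times the closed ball of radius `r` which is jointly continuous and Lipschitz
in space, and whose derivative in space at `0` is `D`, uniformly in time. -/
structure UniformC1 (a b r : ℝ) (Φ : ℝ → E → V) (D : ℝ → E →L[ℝ] V) : Prop where
  continuousOn : ContinuousOn (uncurry Φ) (Icc a b ×ˢ closedBall 0 r)
  continuousOn_deriv : ContinuousOn D (Icc a b)
  lipschitz : ∃ K : NNReal, ∀ t ∈ Icc a b, LipschitzOnWith K (Φ t) (closedBall 0 r)
  approx : ∀ ε > 0, ∀ᶠ x in 𝓝 (0 : E), ∀ t ∈ Icc a b, ‖Φ t x - Φ t 0 - D t x‖ ≤ ε * ‖x‖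

theorem UniformC1.continuousOn_comp {Φ : ℝ → E → V} {D : ℝ → E →L[ℝ] V} (h : UniformC1 a b r Φ D)
    {x : ℝ → E} (hx : ContinuousOn x (Icc a b)) (hxr : MapsTo x (Icc a b) (closedBall 0 r)) :
    ContinuousOn (fun s => Φ s (x s)) (Icc a b) :=
  h.continuousOn.comp (f := fun s => (s, x s)) (by fun_prop) fun s hs => ⟨hs, hxr hs⟩

theorem UniformC1.continuousOn_sub {Φ : ℝ → E → V} {D : ℝ → E →L[ℝ] V} (h : UniformC1 a b r Φ D)
    (hr : 0 ≤ r) {x : ℝ → E} (hx : ContinuousOn x (Icc a b))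
    (hxr : MapsTo x (Icc a b) (closedBall 0 r)) :
    ContinuousOn (fun s => Φ s (x s) - Φ s 0) (Icc a b) :=
  (h.continuousOn_comp hx hxr).sub
    (h.continuousOn_comp continuousOn_const fun _ _ => mem_closedBall_self hr)

theorem UniformC1.continuousOn_sub_sub {Φ : ℝ → E → V} {D : ℝ → E →L[ℝ] V}
    (h : UniformC1 a b r Φ D) (hr : 0 ≤ r) {x : ℝ → E} (hx : ContinuousOn x (Icc a b))
    (hxr : MapsTo x (Icc a b) (closedBall 0 r)) :
    ContinuousOn (fun s => Φ s (x s) - Φ s 0 - D s (x s)) (Icc a b) :=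
  (h.continuousOn_sub hr hx hxr).sub (h.continuousOn_deriv.clm_apply hx)

theorem eventually_norm_sub_sub_le_of_hasFDerivAt {X : Type*} [PseudoMetricSpace X] {K : Set X}
    (hK : IsCompact K) {Φ : X → E → V} {Φ' : X → E → E →L[ℝ] V} {U : Set E} (hU : U ∈ 𝓝 0)
    (hc : ContinuousOn (uncurry Φ') (K ×ˢ U))
    (hd : ∀ t ∈ K, ∀ x ∈ U, HasFDerivAt (Φ t) (Φ' t x) x) {ε : ℝ} (hε : 0 < ε) :
    ∀ᶠ x in 𝓝 (0 : E), ∀ t ∈ K, ‖Φ t x - Φ t 0 - Φ' t 0 x‖ ≤ ε * ‖x‖ := by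
  obtain ⟨W, hW, hclose⟩ := hK.mem_uniformity_of_prod (f := fun x t => Φ' t x)
    (hc.comp continuous_swap.continuousOn fun _ h => ⟨h.2, h.1⟩) (mem_of_mem_nhds hU)
    (dist_mem_uniformity hε)
  rw [nhdsWithin_eq_nhds.2 hU] at hW
  obtain ⟨δ, hδ, h⟩ := Metric.nhds_basis_ball.mem_iff.1 (inter_mem hW hU)
  filter_upwards [ball_mem_nhds 0 hδ] with x hx t ht
  have hΦ' : ∀ z ∈ ball (0 : E) δ, ‖Φ' t z - Φ' t 0‖ ≤ ε := fun z hz => by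
    rw [← dist_eq_norm]
    exact le_of_lt (hclose z (h hz).1 t ht)
  have := (convex_ball (0 : E) δ).norm_image_sub_le_of_norm_hasFDerivWithin_le'
    (f := Φ t) (φ := Φ' t 0) (fun z hz => (hd t ht z (h hz).2).hasFDerivWithinAt)
    hΦ' (mem_ball_self hδ) hx
  simpa using this

theorem UniformC1.of_hasFDerivAt [ProperSpace E] {R : ℝ} (hr : 0 < r) (hrR : r < R)
    {Φ : ℝ → E → V} {Φ' : ℝ → E → E →L[ℝ] V}
    (hc : ContinuousOn (uncurry Φ) (Icc a b ×ˢ ball 0 R))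
    (hc' : ContinuousOn (uncurry Φ') (Icc a b ×ˢ ball 0 R))
    (hd : ∀ t ∈ Icc a b, ∀ x ∈ ball (0 : E) R, HasFDerivAt (Φ t) (Φ' t x) x) :
    UniformC1 a b r Φ (fun t => Φ' t 0) where
  continuousOn := hc.mono (prod_mono_right (closedBall_subset_ball hrR))
  continuousOn_deriv := hc'.comp (f := fun t => (t, (0 : E))) (by fun_prop)
    fun t ht => ⟨ht, mem_ball_self (hr.trans hrR)⟩
  lipschitz := by
    have hsub := closedBall_subset_ball (x := (0 : E)) hrR
    obtain ⟨K, hK⟩ := (isCompact_Icc.prod (isCompact_closedBall 0 r)).exists_bound_of_continuousOn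
      (hc'.mono (prod_mono_right hsub))
    refine ⟨K.toNNReal, fun t ht =>
      (convex_closedBall 0 r).lipschitzOnWith_of_nnnorm_hasFDerivWithin_le
        (fun z hz => (hd t ht z (hsub hz)).hasFDerivWithinAt) fun z hz => ?_⟩
    exact NNReal.le_toNNReal_of_coe_le (hK (t, z) ⟨ht, hz⟩)
  approx ε hε := eventually_norm_sub_sub_le_of_hasFDerivAt isCompact_Icc
    (ball_mem_nhds 0 (hr.trans hrR)) hc' hd hε

theorem UniformC1.isLittleO_integral_norm {Θ : Type*} {l : Filter Θ} {Φ : ℝ → E → V}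
    {D : ℝ → E →L[ℝ] V} (h : UniformC1 a b r Φ D) (hab : a ≤ b) {X : Θ → ℝ → E} {d : Θ → ℝ} {C : ℝ}
    (hd : Tendsto d l (𝓝 0)) (hX : ∀ᶠ θ in l, ∀ s ∈ Icc a b, ‖X θ s‖ ≤ C * d θ) :
    (fun θ => ∫ s in a..b, ‖Φ s (X θ s) - Φ s 0 - D s (X θ s)‖) =o[l] d := by
  refine Asymptotics.isLittleO_iff.2 fun c hc => ?_
  obtain ⟨ε, hε, hεc⟩ := exists_pos_mul_lt hc (|C| * |b - a|)
  obtain ⟨δ, hδ, happrox⟩ := Metric.eventually_nhds_iff_ball.1 (h.approx ε hε)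
  have hCd : ∀ᶠ θ in l, C * d θ < δ := by
    simpa using (hd.const_mul C).eventually (gt_mem_nhds (by simpa))
  filter_upwards [hX, hCd] with θ hθ hθδ
  calc ‖∫ s in a..b, ‖Φ s (X θ s) - Φ s 0 - D s (X θ s)‖‖
      ≤ ε * (|C| * |d θ|) * |b - a| := by
        refine intervalIntegral.norm_integral_le_of_norm_le_const fun s hs => ?_
        rw [uIoc_of_le hab] at hs
        have hs' := Ioc_subset_Icc_self hs
        rw [norm_norm]
        refine (happrox _ (mem_ball_zero_iff.2 ((hθ s hs').trans_lt hθδ)) s hs').trans ?_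
        gcongr
        exact (hθ s hs').trans ((le_abs_self _).trans_eq (abs_mul _ _))
    _ = |C| * |b - a| * ε * |d θ| := by ring
    _ ≤ c * ‖d θ‖ := by rw [Real.norm_eq_abs]; gcongr

theorem UniformC1.isLittleO_integral {Θ : Type*} {l : Filter Θ} {Φ : ℝ → E → V}
    {D : ℝ → E →L[ℝ] V} (h : UniformC1 a b r Φ D) (hab : a ≤ b) {X : Θ → ℝ → E} {d : Θ → ℝ} {C : ℝ}
    (hd : Tendsto d l (𝓝 0)) (hX : ∀ᶠ θ in l, ∀ s ∈ Icc a b, ‖X θ s‖ ≤ C * d θ) :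
    (fun θ => ∫ s in a..b, (Φ s (X θ s) - Φ s 0 - D s (X θ s))) =o[l] d :=
  (Asymptotics.IsBigO.of_norm_le fun _ =>
    intervalIntegral.norm_integral_le_integral_norm hab).trans_isLittleO
      (h.isLittleO_integral_norm hab hd hX)

theorem isLittleO_sub_sub_of_hasFDerivAt {Θ : Type*} {l : Filter Θ} {ψ : E → V} {ψ' : E →L[ℝ] V}
    (hψ : HasFDerivAt ψ ψ' 0) {X : Θ → E} {d : Θ → ℝ} (hd : Tendsto d l (𝓝 0)) (hX : X =O[l] d) :
    (fun θ => ψ (X θ) - ψ 0 - ψ' (X θ)) =o[l] d := by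
  simpa only [comp_def, sub_zero] using
    (hψ.isLittleO.comp_tendsto (hX.trans_tendsto hd)).trans_isBigO (by simpa [comp_def] using hX)

/-- A continuous solution on `[a, b]` of the adjoint equation `p' = -p ∘ A - Dℓ`, which holds at the
times outside of `S`. -/
structure IsAdjointCurve (A : ℝ → E →L[ℝ] E) (Dℓ : ℝ → E →L[ℝ] ℝ) (a b : ℝ) (S : Set ℝ)
    (p : ℝ → E →L[ℝ] ℝ) : Prop where
  continuousOn : ContinuousOn p (Icc a b)
  hasDerivAt : ∀ s ∈ Ioo a b, s ∉ S → HasDerivAt p (-(p s ∘L A s) - Dℓ s) s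

namespace IsAdjointCurve

variable {A : ℝ → E →L[ℝ] E} {Dℓ : ℝ → E →L[ℝ] ℝ} {S S' : Set ℝ} {p : ℝ → E →L[ℝ] ℝ} {x v : ℝ → E}

theorem intervalIntegrable_apply (hp : IsAdjointCurve A Dℓ a b S p) (hab : a ≤ b)
    (hv : IntervalIntegrable v volume a b) : IntervalIntegrable (fun s => p s (v s)) volume a b :=
  intervalIntegrable_bilin_of_continuousOn (ContinuousLinearMap.id ℝ (E →L[ℝ] ℝ)).flip hab hv
    hp.continuousOn

theorem apply_eq_integral (hp : IsAdjointCurve A Dℓ a b S p) (hab : a ≤ b) (hS : S.Countable)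
    (hS' : S'.Countable) (hA : IntervalIntegrable A volume a b)
    (hℓ : IntervalIntegrable Dℓ volume a b) (hv : IntervalIntegrable v volume a b)
    (hx : ContinuousOn x (Icc a b)) (hx₀ : x a = 0)
    (hxv : ∀ s ∈ Ioo a b, s ∉ S' → HasDerivAt x (v s) s) :
    p b (x b) = ∫ s in a..b, (p s (v s - A s (x s)) - Dℓ s (x s)) := by
  have hAx := intervalIntegrable_clm_apply_of_continuousOn hab hA hx
  have hℓx := intervalIntegrable_clm_apply_of_continuousOn hab hℓ hx
  rw [integral_eq_of_hasDerivAt_off_countable_of_le (fun s => p s (x s)) _ hab (hS.union hS')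
    (hp.continuousOn.clm_apply hx) (fun s hs => ?_)
    ((hp.intervalIntegrable_apply hab (hv.sub hAx)).sub hℓx)]
  · simp [hx₀]
  · rw [Set.mem_sdiff, mem_union, not_or] at hs
    convert! (hp.hasDerivAt s hs.1 hs.2.1).clm_apply (hxv s hs.1 hs.2.2) using 1
    simp
    ring

theorem cost_sub_eq (hp : IsAdjointCurve A Dℓ a b S p) (hab : a ≤ b) (hS : S.Countable)
    (hS' : S'.Countable) (hA : IntervalIntegrable A volume a b)
    (hDℓ : IntervalIntegrable Dℓ volume a b) (hv : IntervalIntegrable v volume a b)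
    (hx : ContinuousOn x (Icc a b)) (hx₀ : x a = 0)
    (hxv : ∀ s ∈ Ioo a b, s ∉ S' → HasDerivAt x (v s) s) {v₀ : ℝ → E} {ℓ : ℝ → E → ℝ} {ψ : E → ℝ}
    (hv₀ : IntervalIntegrable v₀ volume a b)
    (hℓ : IntervalIntegrable (fun s => ℓ s (x s)) volume a b)
    (hℓ₀ : IntervalIntegrable (fun s => ℓ s 0) volume a b) :
    ((∫ s in a..b, ℓ s (x s)) + ψ (x b)) - ((∫ s in a..b, ℓ s 0) + ψ 0) - ∫ s in a..b, p s (v₀ s)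
      = (ψ (x b) - ψ 0 - p b (x b)) + (∫ s in a..b, (ℓ s (x s) - ℓ s 0 - Dℓ s (x s)))
        + ∫ s in a..b, p s (v s - v₀ s - A s (x s)) := by
  have hAx := intervalIntegrable_clm_apply_of_continuousOn hab hA hx
  have hDx := intervalIntegrable_clm_apply_of_continuousOn hab hDℓ hx
  have hpv := hp.intervalIntegrable_apply hab (hv.sub hAx)
  have hsplit : ∫ s in a..b, p s (v s - v₀ s - A s (x s))
      = (∫ s in a..b, p s (v s - A s (x s))) - ∫ s in a..b, p s (v₀ s) := by
    rw [← intervalIntegral.integral_sub hpv (hp.intervalIntegrable_apply hab hv₀)]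
    simp only [map_sub, sub_right_comm]
  have hdual := hp.apply_eq_integral hab hS hS' hA hDℓ hv hx hx₀ hxv
  rw [intervalIntegral.integral_sub hpv hDx] at hdual
  rw [hsplit, intervalIntegral.integral_sub (hℓ.sub hℓ₀) hDx,
    intervalIntegral.integral_sub hℓ hℓ₀, hdual]
  ring

end IsAdjointCurve

set_option maxSynthPendingDepth 3 in
theorem exists_isAdjointCurve {A : ℝ → E →L[ℝ] E} {Dℓ : ℝ → E →L[ℝ] ℝ} {S : Set ℝ} {K : NNReal}
    (hab : a ≤ b) (hA : IntervalIntegrable A volume a b) (hAK : ∀ s ∈ Icc a b, ‖A s‖₊ ≤ K)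
    (hAc : ∀ s ∈ Ioo a b, s ∉ S → ContinuousAt A s) (hℓ : IntervalIntegrable Dℓ volume a b)
    (hℓc : ∀ s ∈ Ioo a b, s ∉ S → ContinuousAt Dℓ s) (p₁ : E →L[ℝ] ℝ) :
    ∃ p, IsAdjointCurve A Dℓ a b S p ∧ p b = p₁ := by
  have hrefl : ∀ s ∈ Icc a b, a + b - s ∈ Icc a b := fun s hs =>
    ⟨by linarith [hs.2], by linarith [hs.1]⟩
  let precomp : (E →L[ℝ] E) →L[ℝ] (E →L[ℝ] ℝ) →L[ℝ] E →L[ℝ] ℝ :=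
    (ContinuousLinearMap.compL ℝ E E ℝ).flip
  have hℓr : IntervalIntegrable (fun s => Dℓ (a + b - s)) volume a b := by
    simpa using (hℓ.comp_sub_left (a + b)).symm
  have hAr : IntervalIntegrable (fun s => precomp (A (a + b - s))) volume a b := by
    have : IntervalIntegrable (fun s => A (a + b - s)) volume a b := by
      simpa using (hA.comp_sub_left (a + b)).symm
    exact ⟨precomp.integrable_comp this.1, precomp.integrable_comp this.2⟩
  have hnorm : ∀ s ∈ Icc a b, ‖precomp (A (a + b - s))‖₊ ≤ K := fun s hs => by
    refine (NNReal.coe_le_coe.1 ?_).trans (hAK _ (hrefl s hs))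
    refine (precomp.le_of_opNorm_le ?_ _).trans_eq (one_mul _)
    exact (ContinuousLinearMap.opNorm_flip _).trans_le (ContinuousLinearMap.norm_compL_le _ _ _ _)
  obtain ⟨q, hq, hqeq⟩ := exists_eq_add_integral_of_affine hab hAr hnorm hℓr p₁
  refine ⟨fun s => q (a + b - s), ⟨hq.comp (by fun_prop) hrefl, fun s hs hsS => ?_⟩, ?_⟩
  · have hs' : a + b - s ∈ Ioo a b := ⟨by linarith [hs.2], by linarith [hs.1]⟩
    have hderiv := hasDerivAt_of_eq_add_integral
      ((intervalIntegrable_clm_apply_of_continuousOn hab hAr hq).add hℓr) hqeq hs' ?_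
    · convert! hderiv.comp_const_sub (a + b) s using 1
      simp [precomp]
      abel
    · have hsub : ContinuousAt (fun τ => a + b - τ) (a + b - s) := by fun_prop
      have hqc := hq.continuousAt (Icc_mem_nhds hs'.1 hs'.2)
      have hAs : ContinuousAt (fun τ => A (a + b - τ)) (a + b - s) :=
        ContinuousAt.comp (by simpa using hAc s hs hsS) hsub
      have hℓs : ContinuousAt (fun τ => Dℓ (a + b - τ)) (a + b - s) :=
        ContinuousAt.comp (by simpa using hℓc s hs hsS) hsub
      exact (((precomp.continuous.continuousAt.comp hAs).clm_apply hqc).add hℓs)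
  · simpa using hqeq a (left_mem_Icc.2 hab)

end Adjoint

section Weights

theorem unitStep_sub_eq_indicator (a s : ℝ) : unitStep (s - a) = (Ici a).indicator 1 s := by
  simp [unitStep, indicator_apply]

theorem unitStep_sub_sub_unitStep_sub {a b : ℝ} (hab : a ≤ b) (s : ℝ) :
    unitStep (s - a) - unitStep (s - b) = (Ico a b).indicator 1 s := by
  simp only [unitStep_sub_eq_indicator, indicator_apply, mem_Ici, mem_Ico, Pi.one_apply]
  split_ifs <;> grind

theorem unitStep_eventuallyEq {a t : ℝ} (h : t ≠ a) :
    ∀ᶠ s in 𝓝 t, unitStep (s - a) = unitStep (t - a) := by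
  simp only [unitStep, sub_nonneg]
  rcases h.lt_or_gt with h | h
  · filter_upwards [Iio_mem_nhds h] with s hs
    rw [if_neg (not_le.2 hs), if_neg (not_le.2 h)]
  · filter_upwards [Ioi_mem_nhds h] with s hs
    rw [if_pos (mem_Ioi.1 hs).le, if_pos h.le]

theorem intervalIntegrable_unitStep_sub_mul (a : ℝ) {u : ℝ → ℝ} {c d : ℝ}
    (hu : IntervalIntegrable u volume c d) :
    IntervalIntegrable (fun s => unitStep (s - a) * u s) volume c d := by
  have h : (fun s => unitStep (s - a) * u s) = (Ici a).indicator u := by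
    ext s
    by_cases hs : s ∈ Ici a <;> simp [unitStep_sub_eq_indicator, hs]
  rw [h]
  exact ⟨hu.1.indicator measurableSet_Ici, hu.2.indicator measurableSet_Ici⟩

theorem intervalIntegrable_unitStep_sub (a c d : ℝ) :
    IntervalIntegrable (fun s => unitStep (s - a)) volume c d := by
  simpa using intervalIntegrable_unitStep_sub_mul a (intervalIntegrable_const (c := (1 : ℝ)))

theorem integral_abs_unitStep_sub_le {c d : ℝ} (hcd : c ≤ d) (a b : ℝ) :
    ∫ s in c..d, |unitStep (s - a) - unitStep (s - b)| ≤ |a - b| := by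
  wlog hab : a ≤ b generalizing a b
  · simpa only [abs_sub_comm] using this b a (le_of_not_ge hab)
  have h : ∀ s, |unitStep (s - a) - unitStep (s - b)| = (Ico a b).indicator 1 s := fun s => by
    rw [unitStep_sub_sub_unitStep_sub hab, abs_of_nonneg]
    exact indicator_nonneg (fun _ _ => zero_le_one) s
  simp_rw [h]
  rw [intervalIntegral.integral_of_le hcd, integral_indicator_one measurableSet_Ico,
    abs_sub_comm, abs_of_nonneg (sub_nonneg.2 hab), ← Real.volume_real_Ico_of_le hab]
  exact ENNReal.toReal_mono (by simp) (Measure.restrict_apply_le _ _)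

theorem integral_unitStep_mul {a c d : ℝ} (ha : a ∈ Icc c d) {u : ℝ → ℝ}
    (hu : IntervalIntegrable u volume c d) :
    ∫ s in c..d, unitStep (s - a) * u s = ∫ s in a..d, u s := by
  have hi := intervalIntegrable_unitStep_sub_mul a hu
  have hca := intervalIntegrable_left_of_mem_Icc hi ha
  have h₀ : ∫ s in c..a, unitStep (s - a) * u s = 0 := by
    refine intervalIntegral.integral_zero_ae ?_
    filter_upwards [compl_mem_ae_iff.2 (measure_singleton a)] with s hsa hs
    rw [uIoc_of_le ha.1] at hs
    rw [unitStep, if_neg (by linarith [lt_of_le_of_ne hs.2 hsa]), zero_mul]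
  have h₁ : ∫ s in a..d, unitStep (s - a) * u s = ∫ s in a..d, u s :=
    integral_congr_Icc ha.2 fun s hs => by simp [unitStep, hs.1]
  rw [← intervalIntegral.integral_add_adjacent_intervals hca (hca.symm.trans hi), h₀, h₁, zero_add]

variable {n : ℕ} {t₀ t₁ : ℝ}

theorem times_zero (T : Fin n → ℝ) : times t₀ t₁ T 0 = t₀ := by simp [times]

theorem times_last (T : Fin n → ℝ) : times t₀ t₁ T (Fin.last (n + 1)) = t₁ := by
  rw [← Fin.succ_last]
  simp [times, -Fin.succ_last]

theorem times_castSucc_succ (T : Fin n → ℝ) (i : Fin n) :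
    times t₀ t₁ T i.castSucc.succ = T i := by
  simp [times]

theorem times_succ_castSucc (T : Fin n → ℝ) (i : Fin n) :
    times t₀ t₁ T i.succ.castSucc = T i := by
  rw [← Fin.succ_castSucc, times_castSucc_succ]

theorem times_mem_Icc {T : Fin n → ℝ} (hT : T ∈ admissible n t₀ t₁) (j : Fin (n + 2)) :
    times t₀ t₁ T j ∈ Icc t₀ t₁ := by
  have hm : Monotone (times t₀ t₁ T) := hT
  exact ⟨(times_zero T).symm.trans_le (hm (Fin.zero_le j)),
    (hm (Fin.le_last j)).trans_eq (times_last T)⟩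

theorem apply_mem_Icc {T : Fin n → ℝ} (hT : T ∈ admissible n t₀ t₁) (i : Fin n) :
    T i ∈ Icc t₀ t₁ :=
  times_castSucc_succ (t₀ := t₀) (t₁ := t₁) T i ▸ times_mem_Icc hT _

theorem le_of_mem_admissible {T : Fin n → ℝ} (hT : T ∈ admissible n t₀ t₁) : t₀ ≤ t₁ :=
  (times_mem_Icc hT 0).1.trans (times_mem_Icc hT 0).2

theorem abs_times_sub_le (T T' : Fin n → ℝ) (j : Fin (n + 2)) :
    |times t₀ t₁ T' j - times t₀ t₁ T j| ≤ ‖T' - T‖ := by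
  induction j using Fin.cases with
  | zero => simp [times_zero]
  | succ j =>
    induction j using Fin.lastCases with
    | last => simp [times_last]
    | cast i => simpa [times_castSucc_succ] using norm_le_pi_norm (T' - T) i

/-- The factor `1(t - T_{k-1}) - 1(t - T_k)` of the `k`-th mode in the switched field. -/
def modeWeight (t₀ t₁ : ℝ) (T : Fin n → ℝ) (k : Fin (n + 1)) (t : ℝ) : ℝ :=
  unitStep (t - times t₀ t₁ T k.castSucc) - unitStep (t - times t₀ t₁ T k.succ)

theorem abs_modeWeight_le (T : Fin n → ℝ) (k : Fin (n + 1)) (t : ℝ) :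
    |modeWeight t₀ t₁ T k t| ≤ 1 := by
  unfold modeWeight unitStep
  split_ifs <;> norm_num

theorem continuousAt_modeWeight {T : Fin n → ℝ} {t : ℝ} (ht : t ∉ range (times t₀ t₁ T))
    (k : Fin (n + 1)) : ContinuousAt (modeWeight t₀ t₁ T k) t := by
  have h : ∀ j, ContinuousAt (fun s => unitStep (s - times t₀ t₁ T j)) t := fun j =>
    EventuallyEq.continuousAt (unitStep_eventuallyEq fun hj => ht ⟨j, hj.symm⟩)
  exact (h _).sub (h _)

theorem intervalIntegrable_modeWeight (T : Fin n → ℝ) (k : Fin (n + 1)) (a b : ℝ) :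
    IntervalIntegrable (modeWeight t₀ t₁ T k) volume a b :=
  (intervalIntegrable_unitStep_sub _ a b).sub (intervalIntegrable_unitStep_sub _ a b)

theorem norm_modeWeight_smul_le {V : Type*} [SeminormedAddCommGroup V] [NormedSpace ℝ V]
    (T : Fin n → ℝ) (k : Fin (n + 1)) (t : ℝ) (v : V) : ‖modeWeight t₀ t₁ T k t • v‖ ≤ ‖v‖ := by
  rw [norm_smul]
  exact mul_le_of_le_one_left (norm_nonneg v) (abs_modeWeight_le T k t)

theorem intervalIntegrable_modeWeight_smul {V : Type*} [NormedAddCommGroup V] [NormedSpace ℝ V]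
    (T : Fin n → ℝ) (k : Fin (n + 1)) {u : ℝ → V} {a b : ℝ}
    (hu : IntervalIntegrable u volume a b) :
    IntervalIntegrable (fun s => modeWeight t₀ t₁ T k s • u s) volume a b := by
  exact hu.mono_fun ((intervalIntegrable_modeWeight T k a b).def'.aestronglyMeasurable.smul
    hu.def'.aestronglyMeasurable) (ae_of_all _ fun s => norm_modeWeight_smul_le T k s (u s))

theorem intervalIntegrable_abs_modeWeight_sub (T T' : Fin n → ℝ) (k : Fin (n + 1)) (a b : ℝ) :
    IntervalIntegrable (fun s => |modeWeight t₀ t₁ T' k s - modeWeight t₀ t₁ T k s|)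
      volume a b :=
  ((intervalIntegrable_modeWeight T' k a b).sub (intervalIntegrable_modeWeight T k a b)).abs

theorem integral_abs_modeWeight_sub_le (h01 : t₀ ≤ t₁) (T T' : Fin n → ℝ) (k : Fin (n + 1)) :
    ∫ s in t₀..t₁, |modeWeight t₀ t₁ T' k s - modeWeight t₀ t₁ T k s| ≤ 2 * ‖T' - T‖ := by
  have hi : ∀ a b, IntervalIntegrable (fun s => |unitStep (s - a) - unitStep (s - b)|)
      volume t₀ t₁ := fun a b =>
    ((intervalIntegrable_unitStep_sub a _ _).sub (intervalIntegrable_unitStep_sub b _ _)).abs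
  have hle : ∀ j, ∫ s in t₀..t₁,
      |unitStep (s - times t₀ t₁ T' j) - unitStep (s - times t₀ t₁ T j)| ≤ ‖T' - T‖ := fun j =>
    (integral_abs_unitStep_sub_le h01 _ _).trans (abs_times_sub_le T T' j)
  calc ∫ s in t₀..t₁, |modeWeight t₀ t₁ T' k s - modeWeight t₀ t₁ T k s|
      ≤ ∫ s in t₀..t₁,
          (|unitStep (s - times t₀ t₁ T' k.castSucc) - unitStep (s - times t₀ t₁ T k.castSucc)|
            + |unitStep (s - times t₀ t₁ T' k.succ) - unitStep (s - times t₀ t₁ T k.succ)|) := by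
        refine intervalIntegral.integral_mono_on h01
          (intervalIntegrable_abs_modeWeight_sub T T' k _ _) ((hi _ _).add (hi _ _)) fun s _ => ?_
        rw [modeWeight, modeWeight, sub_sub_sub_comm]
        exact abs_sub _ _
    _ ≤ 2 * ‖T' - T‖ := by
        rw [intervalIntegral.integral_add (hi _ _) (hi _ _), two_mul]
        exact add_le_add (hle _) (hle _)

theorem integral_modeWeight_mul {T : Fin n → ℝ} (hT : T ∈ admissible n t₀ t₁) (k : Fin (n + 1))
    {u : ℝ → ℝ} (hu : IntervalIntegrable u volume t₀ t₁) :
    ∫ s in t₀..t₁, modeWeight t₀ t₁ T k s * u s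
      = (∫ s in t₀..times t₀ t₁ T k.succ, u s) - ∫ s in t₀..times t₀ t₁ T k.castSucc, u s := by
  have hsub : ∀ j, IntervalIntegrable u volume t₀ (times t₀ t₁ T j) := fun j =>
    intervalIntegrable_left_of_mem_Icc hu (times_mem_Icc hT j)
  simp_rw [modeWeight, sub_mul]
  rw [intervalIntegral.integral_sub (intervalIntegrable_unitStep_sub_mul _ hu)
      (intervalIntegrable_unitStep_sub_mul _ hu),
    integral_unitStep_mul (times_mem_Icc hT _) hu, integral_unitStep_mul (times_mem_Icc hT _) hu,
    ← intervalIntegral.integral_interval_sub_left hu (hsub k.castSucc),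
    ← intervalIntegral.integral_interval_sub_left hu (hsub k.succ)]
  ring

theorem sum_integral_modeWeight_mul {T : Fin n → ℝ} (hT : T ∈ admissible n t₀ t₁)
    {u : Fin (n + 1) → ℝ → ℝ} (hu : ∀ k, IntervalIntegrable (u k) volume t₀ t₁) :
    ∑ k, ∫ s in t₀..t₁, modeWeight t₀ t₁ T k s * u k s
      = (∑ i : Fin n, ((∫ s in t₀..T i, u i.castSucc s) - ∫ s in t₀..T i, u i.succ s))
        + ∫ s in t₀..t₁, u (Fin.last n) s := by
  simp_rw [fun k => integral_modeWeight_mul hT k (hu k)]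
  rw [Finset.sum_sub_distrib, Fin.sum_univ_castSucc, Fin.sum_univ_succ (n := n)
    (f := fun k => ∫ s in t₀..times t₀ t₁ T k.castSucc, u k s), Finset.sum_sub_distrib]
  simp_rw [times_castSucc_succ, times_succ_castSucc]
  rw [Fin.succ_last, times_last, Fin.castSucc_zero, times_zero, intervalIntegral.integral_same]
  ring

theorem hasFDerivWithinAt_sum_integral_modeWeight {T : Fin n → ℝ} (hT : T ∈ admissible n t₀ t₁)
    {u : Fin (n + 1) → ℝ → ℝ} (hu : ∀ k, ContinuousOn (u k) (Icc t₀ t₁)) :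
    HasFDerivWithinAt
      (fun T' : Fin n → ℝ => ∑ k, ∫ s in t₀..t₁, modeWeight t₀ t₁ T' k s * u k s)
      (∑ i : Fin n, (u i.castSucc (T i) - u i.succ (T i)) •
        (ContinuousLinearMap.proj i : (Fin n → ℝ) →L[ℝ] ℝ)) (admissible n t₀ t₁) T := by
  have h01 := le_of_mem_admissible hT
  choose v hv hvu using fun k => exists_continuous_eqOn_Icc h01 (hu k)
  have hsum : ∀ T' ∈ admissible n t₀ t₁,
      ∑ k, ∫ s in t₀..t₁, modeWeight t₀ t₁ T' k s * u k s
        = (∑ i : Fin n, ((∫ s in t₀..T' i, v i.castSucc s) - ∫ s in t₀..T' i, v i.succ s))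
          + ∫ s in t₀..t₁, v (Fin.last n) s := fun T' hT' => by
    rw [← sum_integral_modeWeight_mul hT' fun k => (hv k).intervalIntegrable _ _]
    exact Finset.sum_congr rfl fun k _ =>
      integral_congr_Icc h01 fun s hs => by simp only [hvu k hs]
  have hprim : ∀ k t, HasDerivAt (fun t => ∫ s in t₀..t, v k s) (v k t) t := fun k t =>
    ((hv k).integral_hasStrictDerivAt t₀ t).hasDerivAt
  refine HasFDerivWithinAt.congr ?_ hsum (hsum T hT)
  refine (HasFDerivAt.add_const _ (HasFDerivAt.fun_sum fun i _ => ?_)).hasFDerivWithinAt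
  rw [← hvu _ (apply_mem_Icc hT i), ← hvu _ (apply_mem_Icc hT i)]
  have hproj : HasFDerivAt (fun T' : Fin n → ℝ => T' i)
    (ContinuousLinearMap.proj i : (Fin n → ℝ) →L[ℝ] ℝ) T := hasFDerivAt_apply i T
  exact ((hprim i.castSucc (T i)).sub (hprim i.succ (T i))).comp_hasFDerivAt T hproj

end Weights

section Deviation

variable {E : Type*} [NormedAddCommGroup E] [NormedSpace ℝ E] {n : ℕ} {t₀ t₁ r : ℝ}

/-- The field `∑ₖ (wₖ(T', t) Pₖ(t, x) - wₖ(T, t) Qₖ(t, x))`, with `wₖ` the weights of the modes. It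
governs the deviation `x` from the trajectory with transition times `T` when the transition times
are changed to `T'`. -/
def deviationField (t₀ t₁ : ℝ) (P Q : Fin (n + 1) → ℝ → E → E) (T T' : Fin n → ℝ) (t : ℝ)
    (x : E) : E :=
  ∑ k, (modeWeight t₀ t₁ T' k t • P k t x - modeWeight t₀ t₁ T k t • Q k t x)

/-- The linearization at `x = 0` of the unperturbed field `deviationField t₀ t₁ P Q T T`. -/
def deviationLinearization (t₀ t₁ : ℝ) (DP DQ : Fin (n + 1) → ℝ → E →L[ℝ] E) (T : Fin n → ℝ)
    (t : ℝ) : E →L[ℝ] E :=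
  ∑ k, modeWeight t₀ t₁ T k t • (DP k t - DQ k t)

theorem intervalIntegrable_deviationLinearization {DP DQ : Fin (n + 1) → ℝ → E →L[ℝ] E}
    (h01 : t₀ ≤ t₁) (hP : ∀ k, ContinuousOn (DP k) (Icc t₀ t₁))
    (hQ : ∀ k, ContinuousOn (DQ k) (Icc t₀ t₁)) (T : Fin n → ℝ) :
    IntervalIntegrable (deviationLinearization t₀ t₁ DP DQ T) volume t₀ t₁ := by
  have h := IntervalIntegrable.sum Finset.univ fun k _ =>
    intervalIntegrable_modeWeight_smul (t₀ := t₀) (t₁ := t₁) T k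
      (((hP k).sub (hQ k)).intervalIntegrable_of_Icc h01)
  rw [Finset.sum_fn] at h
  exact h

theorem hasFDerivAt_deviationField {P Q : Fin (n + 1) → ℝ → E → E}
    {DP DQ : Fin (n + 1) → ℝ → E →L[ℝ] E} {t : ℝ} {x : E}
    (hP : ∀ k, HasFDerivAt (P k t) (DP k t) x) (hQ : ∀ k, HasFDerivAt (Q k t) (DQ k t) x)
    (t₀ t₁ : ℝ) (T : Fin n → ℝ) :
    HasFDerivAt (deviationField t₀ t₁ P Q T T t) (deviationLinearization t₀ t₁ DP DQ T t) x := by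
  simp only [deviationLinearization, smul_sub]
  exact HasFDerivAt.fun_sum fun k _ =>
    ((hP k).const_smul (modeWeight t₀ t₁ T k t)).sub ((hQ k).const_smul (modeWeight t₀ t₁ T k t))

/-- `P` and `Q` are uniformly `C¹` families near `0`, which agree at `0`. -/
structure IsDeviationSystem (t₀ t₁ r : ℝ) (P Q : Fin (n + 1) → ℝ → E → E)
    (DP DQ : Fin (n + 1) → ℝ → E →L[ℝ] E) : Prop where
  pos : 0 < r
  left : ∀ k, UniformC1 t₀ t₁ r (P k) (DP k)
  right : ∀ k, UniformC1 t₀ t₁ r (Q k) (DQ k)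
  agree : ∀ k, ∀ t ∈ Icc t₀ t₁, P k t 0 = Q k t 0

namespace IsDeviationSystem

variable {P Q : Fin (n + 1) → ℝ → E → E} {DP DQ : Fin (n + 1) → ℝ → E →L[ℝ] E}
  {T T' : Fin n → ℝ} {x : ℝ → E}

theorem intervalIntegrable (h : IsDeviationSystem t₀ t₁ r P Q DP DQ) (h01 : t₀ ≤ t₁)
    (T T' : Fin n → ℝ) (hx : ContinuousOn x (Icc t₀ t₁))
    (hxr : MapsTo x (Icc t₀ t₁) (closedBall 0 r)) :
    IntervalIntegrable (fun s => deviationField t₀ t₁ P Q T T' s (x s)) volume t₀ t₁ := by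
  have hsum := IntervalIntegrable.sum Finset.univ fun k _ =>
    (intervalIntegrable_modeWeight_smul (t₀ := t₀) (t₁ := t₁) T' k
      (((h.left k).continuousOn_comp hx hxr).intervalIntegrable_of_Icc h01)).sub
    (intervalIntegrable_modeWeight_smul (t₀ := t₀) (t₁ := t₁) T k
      (((h.right k).continuousOn_comp hx hxr).intervalIntegrable_of_Icc h01))
  simpa only [deviationField, Finset.sum_fn] using hsum

theorem continuousAt (h : IsDeviationSystem t₀ t₁ r P Q DP DQ) (hx : ContinuousOn x (Icc t₀ t₁))
    (hxr : MapsTo x (Icc t₀ t₁) (closedBall 0 r)) {t : ℝ} (ht : t ∈ Ioo t₀ t₁)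
    (hT : t ∉ range (times t₀ t₁ T)) (hT' : t ∉ range (times t₀ t₁ T')) :
    ContinuousAt (fun s => deviationField t₀ t₁ P Q T T' s (x s)) t :=
  have hmem : Icc t₀ t₁ ∈ 𝓝 t := Icc_mem_nhds ht.1 ht.2
  tendsto_finsetSum _ fun k _ =>
    ((continuousAt_modeWeight hT' k).smul
      (((h.left k).continuousOn_comp hx hxr).continuousAt hmem)).sub
    ((continuousAt_modeWeight hT k).smul
      (((h.right k).continuousOn_comp hx hxr).continuousAt hmem))

theorem exists_isCaratheodory (h : IsDeviationSystem t₀ t₁ r P Q DP DQ) (h01 : t₀ ≤ t₁) :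
    ∃ K, ∀ T T' : Fin n → ℝ, IsCaratheodory (deviationField t₀ t₁ P Q T T') t₀ t₁ r K := by
  choose KP hP using fun k => (h.left k).lipschitz
  choose KQ hQ using fun k => (h.right k).lipschitz
  refine ⟨∑ k, (KP k + KQ k), fun T T' => ⟨h01, h.pos.le, fun t ht => ?_, fun x hx hxr =>
    h.intervalIntegrable h01 T T' hx hxr⟩⟩
  refine LipschitzOnWith.of_dist_le_mul fun x hx y hy => ?_
  rw [dist_eq_norm, dist_eq_norm, deviationField, deviationField, ← Finset.sum_sub_distrib,
    NNReal.coe_sum, Finset.sum_mul]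
  refine norm_sum_le_of_le _ fun k _ => ?_
  rw [sub_sub_sub_comm, ← smul_sub, ← smul_sub, NNReal.coe_add, add_mul]
  exact (norm_sub_le _ _).trans (add_le_add
    ((norm_modeWeight_smul_le T' k t _).trans ((hP k t ht).norm_sub_le hx hy))
    ((norm_modeWeight_smul_le T k t _).trans ((hQ k t ht).norm_sub_le hx hy)))

theorem mapsTo_zero (h : IsDeviationSystem t₀ t₁ r P Q DP DQ) :
    MapsTo (fun _ => (0 : E)) (Icc t₀ t₁) (closedBall 0 r) :=
  fun _ _ => mem_closedBall_self h.pos.le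

theorem continuousOn_left_zero (h : IsDeviationSystem t₀ t₁ r P Q DP DQ) (k : Fin (n + 1)) :
    ContinuousOn (fun t => P k t 0) (Icc t₀ t₁) :=
  (h.left k).continuousOn_comp continuousOn_const h.mapsTo_zero

theorem deviationField_zero (h : IsDeviationSystem t₀ t₁ r P Q DP DQ) (T T' : Fin n → ℝ) {t : ℝ}
    (ht : t ∈ Icc t₀ t₁) :
    deviationField t₀ t₁ P Q T T' t 0
      = ∑ k, (modeWeight t₀ t₁ T' k t - modeWeight t₀ t₁ T k t) • P k t 0 := by
  simp only [deviationField, ← h.agree _ t ht, sub_smul]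

theorem exists_integral_norm_zero_le (h : IsDeviationSystem t₀ t₁ r P Q DP DQ) (h01 : t₀ ≤ t₁) :
    ∃ M, ∀ T T' : Fin n → ℝ,
      ∫ s in t₀..t₁, ‖deviationField t₀ t₁ P Q T T' s 0‖ ≤ M * ‖T' - T‖ := by
  choose M hM using fun k => isCompact_Icc.exists_bound_of_continuousOn (h.continuousOn_left_zero k)
  refine ⟨∑ k, |M k| * 2, fun T T' => ?_⟩
  have hi : ∀ k, IntervalIntegrable
      (fun s => |M k| * |modeWeight t₀ t₁ T' k s - modeWeight t₀ t₁ T k s|) volume t₀ t₁ :=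
    fun k => (intervalIntegrable_abs_modeWeight_sub T T' k _ _).const_mul _
  calc ∫ s in t₀..t₁, ‖deviationField t₀ t₁ P Q T T' s 0‖
      ≤ ∫ s in t₀..t₁, ∑ k, |M k| * |modeWeight t₀ t₁ T' k s - modeWeight t₀ t₁ T k s| := by
        refine intervalIntegral.integral_mono_on h01
          (h.intervalIntegrable h01 T T' continuousOn_const h.mapsTo_zero).norm
          (by simpa only [Finset.sum_fn] using IntervalIntegrable.sum _ fun k _ => hi k)
          fun s hs => ?_
        rw [h.deviationField_zero T T' hs]
        refine norm_sum_le_of_le _ fun k _ => ?_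
        rw [norm_smul, mul_comm, Real.norm_eq_abs]
        exact mul_le_mul_of_nonneg_right ((hM k s hs).trans (le_abs_self _)) (abs_nonneg _)
    _ = ∑ k, |M k| * ∫ s in t₀..t₁, |modeWeight t₀ t₁ T' k s - modeWeight t₀ t₁ T k s| := by
        rw [intervalIntegral.integral_finsetSum fun k _ => hi k]
        simp_rw [intervalIntegral.integral_const_mul]
    _ ≤ ∑ k, |M k| * (2 * ‖T' - T‖) := by
        gcongr with k
        exact integral_abs_modeWeight_sub_le h01 T T' k
    _ = (∑ k, |M k| * 2) * ‖T' - T‖ := by simp_rw [Finset.sum_mul, mul_assoc]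

theorem exists_norm_solution_le (h : IsDeviationSystem t₀ t₁ r P Q DP DQ) (h01 : t₀ ≤ t₁) :
    ∃ C, ∀ T T' : Fin n → ℝ, ∀ b ∈ Icc t₀ t₁, ∀ x : ℝ → E,
      IsCaratheodorySolution (deviationField t₀ t₁ P Q T T') t₀ b r x →
      ∀ t ∈ Icc t₀ b, ‖x t‖ ≤ C * ‖T' - T‖ := by
  obtain ⟨K, hK⟩ := h.exists_isCaratheodory h01
  obtain ⟨M, hM⟩ := h.exists_integral_norm_zero_le h01
  refine ⟨M * Real.exp (K * (t₁ - t₀)), fun T T' b hb x hx t ht => ?_⟩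
  have hF := (hK T T').intervalIntegrable_zero.norm
  have hF₀ : ∫ s in t₀..b, ‖deviationField t₀ t₁ P Q T T' s 0‖ ≤ M * ‖T' - T‖ :=
    (intervalIntegral.integral_mono_interval le_rfl hb.1 hb.2
      (ae_of_all _ fun _ => norm_nonneg _) hF).trans (hM T T')
  calc ‖x t‖ ≤ (∫ s in t₀..b, ‖deviationField t₀ t₁ P Q T T' s 0‖) * Real.exp (K * (t - t₀)) :=
        ((hK T T').mono hb).norm_solution_le hx ht
    _ ≤ (M * ‖T' - T‖) * Real.exp (K * (t₁ - t₀)) :=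
        mul_le_mul hF₀ (Real.exp_le_exp.2 (by gcongr; exact ht.2.trans hb.2)) (Real.exp_pos _).le
          ((intervalIntegral.integral_nonneg hb.1 fun _ _ => norm_nonneg _).trans hF₀)
    _ = M * Real.exp (K * (t₁ - t₀)) * ‖T' - T‖ := by ring

theorem eventually_exists_solution [CompleteSpace E] (h : IsDeviationSystem t₀ t₁ r P Q DP DQ)
    (h01 : t₀ ≤ t₁) (T : Fin n → ℝ) :
    ∀ᶠ T' in 𝓝 T, ∃ x, IsCaratheodorySolution (deviationField t₀ t₁ P Q T T') t₀ t₁ r x := by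
  obtain ⟨K, hK⟩ := h.exists_isCaratheodory h01
  obtain ⟨M, hM⟩ := h.exists_integral_norm_zero_le h01
  have hsmall : ∀ᶠ T' in 𝓝 T, M * ‖T' - T‖ * Real.exp (K * (t₁ - t₀)) < r := by
    have hc : ContinuousAt (fun T' => M * ‖T' - T‖ * Real.exp (K * (t₁ - t₀))) T := by fun_prop
    exact hc.eventually (gt_mem_nhds (by simpa using h.pos))
  filter_upwards [hsmall] with T' hT'
  exact (hK T T').exists_solution
    ((mul_le_mul_of_nonneg_right (hM T T') (Real.exp_pos _).le).trans hT'.le)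

theorem norm_deviationField_sub_le (P Q : Fin (n + 1) → ℝ → E → E)
    (DP DQ : Fin (n + 1) → ℝ → E →L[ℝ] E) (T T' : Fin n → ℝ) (t : ℝ) (x : E) :
    ‖deviationField t₀ t₁ P Q T T' t x - deviationField t₀ t₁ P Q T T' t 0
        - deviationLinearization t₀ t₁ DP DQ T t x‖
      ≤ ∑ k, (|modeWeight t₀ t₁ T' k t - modeWeight t₀ t₁ T k t| * ‖P k t x - P k t 0‖
        + (‖P k t x - P k t 0 - DP k t x‖ + ‖Q k t x - Q k t 0 - DQ k t x‖)) := by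
  simp only [deviationField, deviationLinearization, sum_apply, smul_apply, sub_apply,
    ← Finset.sum_sub_distrib]
  refine norm_sum_le_of_le _ fun k _ => ?_
  calc _ = ‖(modeWeight t₀ t₁ T' k t - modeWeight t₀ t₁ T k t) • (P k t x - P k t 0)
        + (modeWeight t₀ t₁ T k t • (P k t x - P k t 0 - DP k t x)
          - modeWeight t₀ t₁ T k t • (Q k t x - Q k t 0 - DQ k t x))‖ := by
        congr 1
        module
    _ ≤ _ := by
        refine (norm_add_le _ _).trans (add_le_add (norm_smul _ _).le ?_)
        exact (norm_sub_le _ _).trans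
          (add_le_add (norm_modeWeight_smul_le T k t _) (norm_modeWeight_smul_le T k t _))

theorem isLittleO_integral_weight_mul_norm (h : IsDeviationSystem t₀ t₁ r P Q DP DQ)
    (h01 : t₀ ≤ t₁) {l : Filter (Fin n → ℝ)} (hl : l ≤ 𝓝 T) {X : (Fin n → ℝ) → ℝ → E} {C : ℝ}
    (hXr : ∀ᶠ T' in l, MapsTo (X T') (Icc t₀ t₁) (closedBall 0 r))
    (hX : ∀ᶠ T' in l, ∀ s ∈ Icc t₀ t₁, ‖X T' s‖ ≤ C * ‖T' - T‖) (k : Fin (n + 1)) :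
    (fun T' => ∫ s in t₀..t₁, |modeWeight t₀ t₁ T' k s - modeWeight t₀ t₁ T k s|
      * ‖P k s (X T' s) - P k s 0‖) =o[l] fun T' => ‖T' - T‖ := by
  obtain ⟨K, hK⟩ := (h.left k).lipschitz
  have hd : Tendsto (fun T' => ‖T' - T‖) l (𝓝 0) := (tendsto_norm_sub_self T).mono_left hl
  suffices (fun T' => ∫ s in t₀..t₁, |modeWeight t₀ t₁ T' k s - modeWeight t₀ t₁ T k s|
      * ‖P k s (X T' s) - P k s 0‖) =O[l] fun T' => ‖T' - T‖ * ‖T' - T‖ from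
    this.trans_isLittleO (by
      simpa using ((Asymptotics.isLittleO_one_iff ℝ).2 hd).mul_isBigO
        (Asymptotics.isBigO_refl (fun T' => ‖T' - T‖) l))
  refine Asymptotics.IsBigO.of_bound (2 * (K * C)) ?_
  filter_upwards [hXr, hX] with T' hr hT'
  have hP : ∀ s ∈ Icc t₀ t₁, ‖P k s (X T' s) - P k s 0‖ ≤ K * (C * ‖T' - T‖) := fun s hs => by
    refine ((hK s hs).norm_sub_le (hr hs) (h.mapsTo_zero hs)).trans ?_
    rw [sub_zero]
    exact mul_le_mul_of_nonneg_left (hT' s hs) K.2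
  calc ‖∫ s in t₀..t₁, |modeWeight t₀ t₁ T' k s - modeWeight t₀ t₁ T k s|
          * ‖P k s (X T' s) - P k s 0‖‖
      ≤ ∫ s in t₀..t₁, |modeWeight t₀ t₁ T' k s - modeWeight t₀ t₁ T k s|
          * (K * (C * ‖T' - T‖)) := by
        refine intervalIntegral.norm_integral_le_of_norm_le h01 (ae_of_all _ fun s hs => ?_)
          ((intervalIntegrable_abs_modeWeight_sub T T' k _ _).mul_const _)
        rw [norm_mul, norm_norm, Real.norm_eq_abs, abs_abs]
        exact mul_le_mul_of_nonneg_left (hP s (Ioc_subset_Icc_self hs)) (abs_nonneg _)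
    _ ≤ 2 * ‖T' - T‖ * (K * (C * ‖T' - T‖)) := by
        rw [intervalIntegral.integral_mul_const]
        exact mul_le_mul_of_nonneg_right (integral_abs_modeWeight_sub_le h01 T T' k)
          ((norm_nonneg _).trans (hP t₀ (left_mem_Icc.2 h01)))
    _ = 2 * (K * C) * ‖‖T' - T‖ * ‖T' - T‖‖ := by
        rw [Real.norm_of_nonneg (by positivity)]
        ring

theorem isLittleO_integral_norm_sub (h : IsDeviationSystem t₀ t₁ r P Q DP DQ) (h01 : t₀ ≤ t₁)
    {l : Filter (Fin n → ℝ)} (hl : l ≤ 𝓝 T) {X : (Fin n → ℝ) → ℝ → E} {C : ℝ}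
    (hXc : ∀ᶠ T' in l, ContinuousOn (X T') (Icc t₀ t₁))
    (hXr : ∀ᶠ T' in l, MapsTo (X T') (Icc t₀ t₁) (closedBall 0 r))
    (hX : ∀ᶠ T' in l, ∀ s ∈ Icc t₀ t₁, ‖X T' s‖ ≤ C * ‖T' - T‖) :
    (fun T' => ∫ s in t₀..t₁, ‖deviationField t₀ t₁ P Q T T' s (X T' s)
        - deviationField t₀ t₁ P Q T T' s 0 - deviationLinearization t₀ t₁ DP DQ T s (X T' s)‖)
      =o[l] fun T' => ‖T' - T‖ := by
  have hd : Tendsto (fun T' => ‖T' - T‖) l (𝓝 0) := (tendsto_norm_sub_self T).mono_left hl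
  refine Asymptotics.IsBigO.trans_isLittleO (Asymptotics.IsBigO.of_bound 1 ?_)
    (Asymptotics.IsLittleO.fun_sum fun k (_ : k ∈ Finset.univ) =>
      (h.isLittleO_integral_weight_mul_norm h01 hl hXr hX k).add
        (((h.left k).isLittleO_integral_norm h01 hd hX).add
          ((h.right k).isLittleO_integral_norm h01 hd hX)))
  filter_upwards [hXc, hXr] with T' hc hr
  have hiP := fun k => ((h.left k).continuousOn_sub_sub h.pos.le hc
    hr).norm.intervalIntegrable_of_Icc (μ := volume) h01
  have hiQ := fun k => ((h.right k).continuousOn_sub_sub h.pos.le hc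
    hr).norm.intervalIntegrable_of_Icc (μ := volume) h01
  have hiw : ∀ k, IntervalIntegrable (fun s => |modeWeight t₀ t₁ T' k s - modeWeight t₀ t₁ T k s|
      * ‖P k s (X T' s) - P k s 0‖) volume t₀ t₁ := fun k =>
    (intervalIntegrable_abs_modeWeight_sub T T' k t₀ t₁).mul_continuousOn (by
      rw [uIcc_of_le h01]
      exact ((h.left k).continuousOn_sub h.pos.le hc hr).norm)
  have hi := fun k => (hiw k).add ((hiP k).add (hiQ k))
  rw [one_mul]
  refine le_trans ?_ (le_abs_self _)
  refine (intervalIntegral.norm_integral_le_of_norm_le h01 (ae_of_all _ fun s _ =>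
    (norm_norm _).trans_le (norm_deviationField_sub_le P Q DP DQ T T' s (X T' s)))
    (by simpa only [Finset.sum_fn] using IntervalIntegrable.sum Finset.univ fun k _ => hi k)).trans
    (le_of_eq ?_)
  rw [intervalIntegral.integral_finsetSum fun k _ => hi k]
  refine Finset.sum_congr rfl fun k _ => ?_
  rw [intervalIntegral.integral_add (hiw k) ((hiP k).add (hiQ k)),
    intervalIntegral.integral_add (hiP k) (hiQ k)]

variable {ℓ : ℝ → E → ℝ} {Dℓ : ℝ → E →L[ℝ] ℝ} {ψ : E → ℝ} {p : ℝ → E →L[ℝ] ℝ}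

theorem exists_isAdjointCurve (h : IsDeviationSystem t₀ t₁ r P Q DP DQ)
    (h01 : t₀ ≤ t₁) (hℓ : ContinuousOn Dℓ (Icc t₀ t₁)) (T : Fin n → ℝ) (p₁ : E →L[ℝ] ℝ) :
    ∃ p, IsAdjointCurve (deviationLinearization t₀ t₁ DP DQ T) Dℓ t₀ t₁ (range (times t₀ t₁ T)) p ∧
      p t₁ = p₁ := by
  have hD : ∀ k, ContinuousOn (fun s => DP k s - DQ k s) (Icc t₀ t₁) := fun k =>
    (h.left k).continuousOn_deriv.sub (h.right k).continuousOn_deriv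
  choose M hM using fun k => isCompact_Icc.exists_bound_of_continuousOn (hD k)
  refine LieSwitched.exists_isAdjointCurve (K := (∑ k, M k).toNNReal) h01
    (intervalIntegrable_deviationLinearization h01 (fun k => (h.left k).continuousOn_deriv)
      (fun k => (h.right k).continuousOn_deriv) T) (fun s hs => ?_) (fun s hs hsT => ?_)
    (hℓ.intervalIntegrable_of_Icc h01) (fun s hs _ => hℓ.continuousAt (Icc_mem_nhds hs.1 hs.2)) p₁
  · exact NNReal.le_toNNReal_of_coe_le (norm_sum_le_of_le _ fun k _ =>
      (norm_modeWeight_smul_le T k s _).trans (hM k s hs))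
  · exact tendsto_finsetSum _ fun k _ =>
      (continuousAt_modeWeight hsT k).smul ((hD k).continuousAt (Icc_mem_nhds hs.1 hs.2))

theorem integral_apply_deviationField_zero (h : IsDeviationSystem t₀ t₁ r P Q DP DQ)
    (h01 : t₀ ≤ t₁) (hp : ContinuousOn p (Icc t₀ t₁)) (T T' : Fin n → ℝ) :
    ∫ s in t₀..t₁, p s (deviationField t₀ t₁ P Q T T' s 0)
      = (∑ k, ∫ s in t₀..t₁, modeWeight t₀ t₁ T' k s * p s (P k s 0))
        - ∑ k, ∫ s in t₀..t₁, modeWeight t₀ t₁ T k s * p s (P k s 0) := by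
  have hi : ∀ (T : Fin n → ℝ) k, IntervalIntegrable
      (fun s => modeWeight t₀ t₁ T k s * p s (P k s 0)) volume t₀ t₁ := fun T k =>
    intervalIntegrable_modeWeight_smul T k
      ((hp.clm_apply (h.continuousOn_left_zero k)).intervalIntegrable_of_Icc h01)
  calc ∫ s in t₀..t₁, p s (deviationField t₀ t₁ P Q T T' s 0)
      = ∫ s in t₀..t₁, ∑ k, (modeWeight t₀ t₁ T' k s * p s (P k s 0)
          - modeWeight t₀ t₁ T k s * p s (P k s 0)) :=
        integral_congr_Icc h01 fun s hs => by
          simp only [h.deviationField_zero T T' hs, map_sum, map_smul, smul_eq_mul, sub_mul]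
    _ = _ := by
        rw [intervalIntegral.integral_finsetSum fun k _ => (hi T' k).sub (hi T k),
          ← Finset.sum_sub_distrib]
        exact Finset.sum_congr rfl fun k _ => intervalIntegral.integral_sub (hi T' k) (hi T k)

theorem isLittleO_integral_apply_sub (h : IsDeviationSystem t₀ t₁ r P Q DP DQ) (h01 : t₀ ≤ t₁)
    (hp : ContinuousOn p (Icc t₀ t₁)) {l : Filter (Fin n → ℝ)} (hl : l ≤ 𝓝 T)
    {X : (Fin n → ℝ) → ℝ → E} {C : ℝ} (hXc : ∀ᶠ T' in l, ContinuousOn (X T') (Icc t₀ t₁))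
    (hXr : ∀ᶠ T' in l, MapsTo (X T') (Icc t₀ t₁) (closedBall 0 r))
    (hX : ∀ᶠ T' in l, ∀ s ∈ Icc t₀ t₁, ‖X T' s‖ ≤ C * ‖T' - T‖) :
    (fun T' => ∫ s in t₀..t₁, p s (deviationField t₀ t₁ P Q T T' s (X T' s)
        - deviationField t₀ t₁ P Q T T' s 0 - deviationLinearization t₀ t₁ DP DQ T s (X T' s)))
      =o[l] fun T' => ‖T' - T‖ := by
  obtain ⟨M, hM⟩ := isCompact_Icc.exists_bound_of_continuousOn hp
  refine Asymptotics.IsBigO.trans_isLittleO (Asymptotics.IsBigO.of_bound M ?_)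
    (h.isLittleO_integral_norm_sub h01 hl hXc hXr hX)
  filter_upwards [hXc, hXr] with T' hc hr
  have hi := ((h.intervalIntegrable h01 T T' hc hr).sub
    (h.intervalIntegrable h01 T T' continuousOn_const h.mapsTo_zero)).sub
      (intervalIntegrable_clm_apply_of_continuousOn h01
        (intervalIntegrable_deviationLinearization h01 (fun k => (h.left k).continuousOn_deriv)
          (fun k => (h.right k).continuousOn_deriv) T) hc)
  rw [Real.norm_of_nonneg (intervalIntegral.integral_nonneg h01 fun _ _ => norm_nonneg _),
    ← intervalIntegral.integral_const_mul]
  exact intervalIntegral.norm_integral_le_of_norm_le h01 (ae_of_all _ fun s hs =>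
    (p s).le_of_opNorm_le (hM s (Ioc_subset_Icc_self hs)) _) (hi.norm.const_mul M)

theorem isLittleO_cost_sub [CompleteSpace E] (h : IsDeviationSystem t₀ t₁ r P Q DP DQ)
    (h01 : t₀ ≤ t₁) (hℓ : UniformC1 t₀ t₁ r ℓ Dℓ) (hψ : HasFDerivAt ψ (p t₁) 0)
    (hp : IsAdjointCurve (deviationLinearization t₀ t₁ DP DQ T) Dℓ t₀ t₁ (range (times t₀ t₁ T)) p)
    {l : Filter (Fin n → ℝ)} (hl : l ≤ 𝓝 T) {X : (Fin n → ℝ) → ℝ → E}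
    (hX : ∀ᶠ T' in l, IsCaratheodorySolution (deviationField t₀ t₁ P Q T T') t₀ t₁ r (X T')) :
    (fun T' => ((∫ s in t₀..t₁, ℓ s (X T' s)) + ψ (X T' t₁)) - ((∫ s in t₀..t₁, ℓ s 0) + ψ 0)
      - ∫ s in t₀..t₁, p s (deviationField t₀ t₁ P Q T T' s 0)) =o[l] fun T' => ‖T' - T‖ := by
  obtain ⟨K, hK⟩ := h.exists_isCaratheodory h01
  obtain ⟨C, hC⟩ := h.exists_norm_solution_le h01
  have hA := intervalIntegrable_deviationLinearization h01 (fun k => (h.left k).continuousOn_deriv)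
    (fun k => (h.right k).continuousOn_deriv) T
  have hd : Tendsto (fun T' => ‖T' - T‖) l (𝓝 0) := (tendsto_norm_sub_self T).mono_left hl
  have hXc := hX.mono fun T' hx => hx.continuousOn
  have hXr := hX.mono fun T' hx => hx.mapsTo
  have hXn : ∀ᶠ T' in l, ∀ s ∈ Icc t₀ t₁, ‖X T' s‖ ≤ C * ‖T' - T‖ :=
    hX.mono fun T' hx => hC T T' t₁ (right_mem_Icc.2 h01) (X T') hx
  have hX₁ : (fun T' => X T' t₁) =O[l] fun T' => ‖T' - T‖ :=
    Asymptotics.IsBigO.of_bound C (by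
      simpa only [norm_norm] using hXn.mono fun T' hx => hx t₁ (right_mem_Icc.2 h01))
  refine (((isLittleO_sub_sub_of_hasFDerivAt hψ hd hX₁).add
    (hℓ.isLittleO_integral h01 hd hXn)).add
    (h.isLittleO_integral_apply_sub h01 hp.continuousOn hl hXc hXr hXn)).congr' ?_ EventuallyEq.rfl
  filter_upwards [hX] with T' hx
  have hxF := (hK T T').intervalIntegrable (X T') hx.continuousOn hx.mapsTo
  refine (hp.cost_sub_eq h01 (countable_range _)
    ((countable_range (times t₀ t₁ T)).union (countable_range (times t₀ t₁ T'))) hA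
    (hℓ.continuousOn_deriv.intervalIntegrable_of_Icc h01) hxF hx.continuousOn ?_ ?_
    (hK T T').intervalIntegrable_zero
    ((hℓ.continuousOn_comp hx.continuousOn hx.mapsTo).intervalIntegrable_of_Icc h01)
    ((hℓ.continuousOn_comp continuousOn_const h.mapsTo_zero).intervalIntegrable_of_Icc h01)).symm
  · rw [hx.eq_integral t₀ (left_mem_Icc.2 h01), intervalIntegral.integral_same]
  · intro s hs hsT
    rw [mem_union, not_or] at hsT
    exact (hK T T').hasDerivAt_solution hx hs
      (h.continuousAt hx.continuousOn hx.mapsTo hs hsT.1 hsT.2)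

theorem hasFDerivWithinAt_cost [CompleteSpace E] (h : IsDeviationSystem t₀ t₁ r P Q DP DQ)
    (hT : T ∈ admissible n t₀ t₁) (hℓ : UniformC1 t₀ t₁ r ℓ Dℓ) (hψ : HasFDerivAt ψ (p t₁) 0)
    (hp : IsAdjointCurve (deviationLinearization t₀ t₁ DP DQ T) Dℓ t₀ t₁ (range (times t₀ t₁ T)) p)
    {J : (Fin n → ℝ) → ℝ}
    (hJ : ∀ᶠ T' in 𝓝[admissible n t₀ t₁] T, ∃ x,
      IsCaratheodorySolution (deviationField t₀ t₁ P Q T T') t₀ t₁ r x ∧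
      J T' = (∫ s in t₀..t₁, ℓ s (x s)) + ψ (x t₁)) :
    HasFDerivWithinAt J
      (∑ i : Fin n, (p (T i) (P i.castSucc (T i) 0) - p (T i) (P i.succ (T i) 0)) •
        (ContinuousLinearMap.proj i : (Fin n → ℝ) →L[ℝ] ℝ)) (admissible n t₀ t₁) T := by
  have h01 := le_of_mem_admissible hT
  have hJT : J T = (∫ s in t₀..t₁, ℓ s 0) + ψ 0 := by
    obtain ⟨x, hx, hxJ⟩ := hJ.self_of_nhdsWithin hT
    obtain ⟨C, hC⟩ := h.exists_norm_solution_le h01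
    have hx0 : ∀ s ∈ Icc t₀ t₁, x s = 0 := fun s hs => by
      simpa using hC T T t₁ (right_mem_Icc.2 h01) x hx s hs
    rw [hxJ, hx0 t₁ (right_mem_Icc.2 h01)]
    congr 1
    exact integral_congr_Icc h01 fun s hs => by simp only [hx0 s hs]
  have : (𝓝[admissible n t₀ t₁] T).NeBot := mem_closure_iff_nhdsWithin_neBot.1 (subset_closure hT)
  obtain ⟨X, hX⟩ := hJ.choice
  have hweights := hasFDerivWithinAt_sum_integral_modeWeight hT (u := fun k s => p s (P k s 0))
    fun k => hp.continuousOn.clm_apply (h.continuousOn_left_zero k)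
  refine HasFDerivWithinAt.of_isLittleO ?_
  refine ((h.isLittleO_cost_sub h01 hℓ hψ hp nhdsWithin_le_nhds
    (hX.mono fun T' hx => hx.1)).of_norm_right.add hweights.isLittleO).congr' ?_ EventuallyEq.rfl
  filter_upwards [hX] with T' hx
  rw [hx.2, hJT, h.integral_apply_deviationField_zero h01 hp.continuousOn T T']
  ring

end IsDeviationSystem

end Deviation

section ParametricDerivative

variable {E : Type*} [NormedAddCommGroup E] [NormedSpace ℝ E]
  {V : Type*} [NormedAddCommGroup V] [NormedSpace ℝ V]
  {E' : Type*} [NormedAddCommGroup E'] [NormedSpace ℝ E']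
  {H' : Type*} [TopologicalSpace H'] {J : ModelWithCorners ℝ E' H'}
  {N : Type*} [TopologicalSpace N] [ChartedSpace H' N]
  {Φ : N → E → V} {S : Set N} {U : Set E}

theorem hasFDerivAt_of_contMDiffOn (hU : IsOpen U)
    (hΦ : ContMDiffOn (J.prod 𝓘(ℝ, E)) 𝓘(ℝ, V) 1 (fun p : N × E => Φ p.1 p.2) (S ×ˢ U))
    {p : N} (hp : p ∈ S) {x : E} (hx : x ∈ U) : HasFDerivAt (Φ p) (fderiv ℝ (Φ p) x) x := by
  have h : ContMDiffOn 𝓘(ℝ, E) 𝓘(ℝ, V) 1 (Φ p) U :=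
    hΦ.comp (contMDiffOn_const.prodMk contMDiffOn_id) fun y hy => ⟨hp, hy⟩
  exact (((contMDiffOn_iff_contDiffOn.1 h).contDiffAt (hU.mem_nhds hx)).differentiableAt
    (by simp)).hasFDerivAt

theorem continuousOn_fderiv_of_contMDiffOn [IsManifold J 1 N] (hU : IsOpen U)
    (hΦ : ContMDiffOn (J.prod 𝓘(ℝ, E)) 𝓘(ℝ, V) 1 (fun p : N × E => Φ p.1 p.2) (S ×ˢ U)) :
    ContinuousOn (fun p : N × E => fderiv ℝ (Φ p.1) p.2) (S ×ˢ U) := by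
  intro q hq
  have hc : ContMDiffOn ((J.prod 𝓘(ℝ, E)).prod 𝓘(ℝ, E)) 𝓘(ℝ, V) 1
      (uncurry fun (z : N × E) (y : E) => Φ z.1 y) ((S ×ˢ U) ×ˢ U) :=
    hΦ.comp (f := fun z : (N × E) × E => (z.1.1, z.2))
      ((contMDiff_fst.comp contMDiff_fst).prodMk contMDiff_snd).contMDiffOn
      fun z hz => ⟨hz.1.1, hz.2⟩
  have h := ((hc (q, q.2) ⟨hq, hq.2⟩).mfderivWithin (g := Prod.snd) (m := 0)
    contMDiffWithinAt_snd hq (fun z hz => hz.2) (by simp) hU.uniqueMDiffOn).continuousWithinAt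
  have e : ∀ z ∈ S ×ˢ U, fderiv ℝ (Φ z.1) z.2
      = inTangentCoordinates 𝓘(ℝ, E) 𝓘(ℝ, V) Prod.snd (fun z : N × E => Φ z.1 z.2)
        (fun z => mfderivWithin 𝓘(ℝ, E) 𝓘(ℝ, V) (fun y => Φ z.1 y) U z.2) q z := fun z hz =>
    ((congrFun (inTangentCoordinates_model_space (I := 𝓘(ℝ, E)) (I' := 𝓘(ℝ, V)) Prod.snd
      (fun z : N × E => Φ z.1 z.2) _ q) z).trans
      (mfderivWithin_eq_fderivWithin.trans (fderivWithin_of_isOpen hU hz.2))).symm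
  exact h.congr e (e q hq)

theorem UniformC1.of_contMDiffOn [ProperSpace E] [IsManifold J 1 N] (hU : IsOpen U)
    (hΦ : ContMDiffOn (J.prod 𝓘(ℝ, E)) 𝓘(ℝ, V) 1 (fun p : N × E => Φ p.1 p.2) (S ×ˢ U))
    {a b r R : ℝ} (hr : 0 < r) (hrR : r < R) (hRU : ball 0 R ⊆ U) {c : ℝ → N}
    (hc : ContinuousOn c (Icc a b)) (hcS : MapsTo c (Icc a b) S) :
    UniformC1 a b r (fun t => Φ (c t)) (fun t => fderiv ℝ (Φ (c t)) 0) := by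
  have hm : MapsTo (fun z : ℝ × E => (c z.1, z.2)) (Icc a b ×ˢ ball 0 R) (S ×ˢ U) :=
    fun z hz => ⟨hcS hz.1, hRU hz.2⟩
  have hcc : ContinuousOn (fun z : ℝ × E => (c z.1, z.2)) (Icc a b ×ˢ ball 0 R) :=
    (hc.comp continuousOn_fst fun z hz => hz.1).prodMk continuousOn_snd
  exact UniformC1.of_hasFDerivAt (Φ' := fun t x => fderiv ℝ (Φ (c t)) x) hr hrR
    (hΦ.continuousOn.comp hcc hm) ((continuousOn_fderiv_of_contMDiffOn hU hΦ).comp hcc hm)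
    fun t ht x hx => hasFDerivAt_of_contMDiffOn hU hΦ (hcS ht) (hRU hx)

end ParametricDerivative

theorem hasMFDerivAt_comp_of_eq {E E' E'' : Type*} [NormedAddCommGroup E] [NormedSpace ℝ E]
    [NormedAddCommGroup E'] [NormedSpace ℝ E'] [NormedAddCommGroup E''] [NormedSpace ℝ E'']
    {H H' H'' : Type*} [TopologicalSpace H] [TopologicalSpace H'] [TopologicalSpace H'']
    {I : ModelWithCorners ℝ E H} {I' : ModelWithCorners ℝ E' H'} {I'' : ModelWithCorners ℝ E'' H''}
    {M M' M'' : Type*} [TopologicalSpace M] [TopologicalSpace M'] [TopologicalSpace M'']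
    [ChartedSpace H M] [ChartedSpace H' M'] [ChartedSpace H'' M''] {f : M → M'} {g : M' → M''}
    {x : M} {y : M'} {A : E' →L[ℝ] E''} {B : E →L[ℝ] E'} (hg : HasMFDerivAt I' I'' g y A)
    (hf : HasMFDerivAt I I' f x B) (hy : f x = y) :
    HasMFDerivAt I I'' (fun z => g (f z)) x (A ∘L B : E →L[ℝ] E'') := by
  subst hy
  exact hg.comp x hf

section Velocity

variable {E : Type*} [NormedAddCommGroup E] [NormedSpace ℝ E]
  {H : Type*} [TopologicalSpace H] (I : ModelWithCorners ℝ E H)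
  {M : Type*} [TopologicalSpace M] [ChartedSpace H M]

/-- The curve `γ` has velocity `v` at time `t`. The tangent vector `v` is read in the preferred
chart at `γ t`, so that velocities at different points can be compared without casts. -/
def HasVelocityAt (γ : ℝ → M) (v : E) (t : ℝ) : Prop :=
  HasMFDerivAt 𝓘(ℝ, ℝ) I γ t ((1 : ℝ →L[ℝ] ℝ).smulRight v : ℝ →L[ℝ] E)

theorem hasVelocityAt_const (a : M) (t : ℝ) : HasVelocityAt I (fun _ => a) 0 t := by
  have e : (1 : ℝ →L[ℝ] ℝ).smulRight (0 : E) = 0 := by ext; simp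
  rw [HasVelocityAt, e]
  exact hasMFDerivAt_const a t

theorem hasVelocityAt_iff_hasDerivAt {x : ℝ → E} {v : E} {t : ℝ} :
    HasVelocityAt 𝓘(ℝ, E) x v t ↔ HasDerivAt x v t := by
  rw [HasVelocityAt, hasDerivAt_iff_hasFDerivAt]
  exact hasMFDerivAt_iff_hasFDerivAt

namespace HasVelocityAt

variable {I} {γ : ℝ → M} {v w : E} {t : ℝ}
  {E' : Type*} [NormedAddCommGroup E'] [NormedSpace ℝ E']
  {H' : Type*} [TopologicalSpace H'] {I' : ModelWithCorners ℝ E' H'}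
  {M' : Type*} [TopologicalSpace M'] [ChartedSpace H' M']

theorem congr_of_eventuallyEq {δ : ℝ → M} (h : HasVelocityAt I γ v t) (he : δ =ᶠ[𝓝 t] γ) :
    HasVelocityAt I δ v t :=
  HasMFDerivAt.congr_of_eventuallyEq h he

theorem unique (h : HasVelocityAt I γ v t) (h' : HasVelocityAt I γ w t) : v = w := by
  have e : ((1 : ℝ →L[ℝ] ℝ).smulRight v : ℝ →L[ℝ] E) = (1 : ℝ →L[ℝ] ℝ).smulRight w :=
    hasMFDerivAt_unique h h'
  simpa using DFunLike.congr_fun e 1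

theorem comp (h : HasVelocityAt I γ v t) {F : M → M'} {D : E →L[ℝ] E'}
    (hF : HasMFDerivAt I I' F (γ t) D) : HasVelocityAt I' (fun s => F (γ s)) (D v) t := by
  have e : (1 : ℝ →L[ℝ] ℝ).smulRight (D v) = D ∘L ((1 : ℝ →L[ℝ] ℝ).smulRight v) := by ext; simp
  rw [HasVelocityAt, e]
  exact HasMFDerivAt.comp t hF h

theorem prodMk {δ : ℝ → M'} {u : E'} (h : HasVelocityAt I γ v t) (h' : HasVelocityAt I' δ u t) :
    HasVelocityAt (I.prod I') (fun s => (γ s, δ s)) (v, u) t := by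
  have e : (1 : ℝ →L[ℝ] ℝ).smulRight (v, u)
      = ((1 : ℝ →L[ℝ] ℝ).smulRight v).prod ((1 : ℝ →L[ℝ] ℝ).smulRight u) := by ext <;> simp
  rw [HasVelocityAt, e]
  exact HasMFDerivAt.prodMk h h'

end HasVelocityAt

end Velocity

section Translations

variable {E : Type*} [NormedAddCommGroup E] [NormedSpace ℝ E]
  {H : Type*} [TopologicalSpace H] (I : ModelWithCorners ℝ E H)
  {G : Type*} [TopologicalSpace G] [ChartedSpace H G] [Group G]

/-- The derivative at `h` of the left translation by `g`, read in the preferred charts. -/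
def leftTrans (g h : G) : E →L[ℝ] E := mfderiv I I (fun k : G => g * k) h

/-- The derivative at `h` of the right translation by `g`, read in the preferred charts. -/
def rightTrans (g h : G) : E →L[ℝ] E := mfderiv I I (fun k : G => k * g) h

variable [LieGroup I ∞ G]

theorem hasMFDerivAt_leftTrans (g h : G) :
    HasMFDerivAt I I (fun k : G => g * k) h (leftTrans I g h : E →L[ℝ] E) :=
  ((contMDiff_mul_left (I := I) (n := ∞) (a := g)).mdifferentiableAt (by simp)).hasMFDerivAt

theorem hasMFDerivAt_rightTrans (g h : G) :
    HasMFDerivAt I I (fun k : G => k * g) h (rightTrans I g h : E →L[ℝ] E) :=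
  ((contMDiff_mul_right (I := I) (n := ∞) (a := g)).mdifferentiableAt (by simp)).hasMFDerivAt

theorem leftTrans_one (h : G) : leftTrans I (1 : G) h = ContinuousLinearMap.id ℝ E := by
  have e : (fun k : G => 1 * k) = id := funext one_mul
  exact hasMFDerivAt_unique (e ▸ hasMFDerivAt_leftTrans I (1 : G) h) (hasMFDerivAt_id h)

theorem rightTrans_one (h : G) : rightTrans I (1 : G) h = ContinuousLinearMap.id ℝ E := by
  have e : (fun k : G => k * 1) = id := funext mul_one
  exact hasMFDerivAt_unique (e ▸ hasMFDerivAt_rightTrans I (1 : G) h) (hasMFDerivAt_id h)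

theorem leftTrans_mul (a b c : G) :
    leftTrans I (a * b) c = leftTrans I a (b * c) ∘L leftTrans I b c := by
  have h := HasMFDerivAt.comp c (hasMFDerivAt_leftTrans I a (b * c)) (hasMFDerivAt_leftTrans I b c)
  have e : (fun k : G => a * k) ∘ (fun k => b * k) = fun k => a * b * k :=
    funext fun k => (mul_assoc a b k).symm
  exact hasMFDerivAt_unique (hasMFDerivAt_leftTrans I (a * b) c) (e ▸ h)

theorem leftTrans_injective (a b : G) : Injective (leftTrans I a b) := by
  refine LeftInverse.injective (g := leftTrans I a⁻¹ (a * b)) fun v => ?_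
  rw [← ContinuousLinearMap.comp_apply, ← leftTrans_mul, inv_mul_cancel, leftTrans_one,
    ContinuousLinearMap.id_apply]

theorem rightTrans_comp_leftTrans (a b c : G) :
    rightTrans I b (a * c) ∘L leftTrans I a c = leftTrans I a (c * b) ∘L rightTrans I b c := by
  have h := HasMFDerivAt.comp c (hasMFDerivAt_rightTrans I b (a * c))
    (hasMFDerivAt_leftTrans I a c)
  have h' := HasMFDerivAt.comp c (hasMFDerivAt_leftTrans I a (c * b))
    (hasMFDerivAt_rightTrans I b c)
  have e : (fun k : G => k * b) ∘ (fun k => a * k) = (fun k => a * k) ∘ fun k => k * b :=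
    funext fun k => mul_assoc a k b
  exact hasMFDerivAt_unique (e ▸ h) h'

variable {I} {g h : ℝ → G} {v ξ ζ : E} {t : ℝ}

theorem HasVelocityAt.mul {w : E} (hg : HasVelocityAt I g v t) (hh : HasVelocityAt I h w t) :
    HasVelocityAt I (fun s => g s * h s)
      (rightTrans I (h t) (g t) v + leftTrans I (g t) (h t) w) t := by
  have hm : MDifferentiableAt (I.prod I) I (fun p : G × G => p.1 * p.2) (g t, h t) :=
    (contMDiff_mul I ∞).mdifferentiableAt (by simp)
  have e : rightTrans I (h t) (g t) v + leftTrans I (g t) (h t) w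
      = (mfderiv (I.prod I) I (fun p : G × G => p.1 * p.2) (g t, h t) : E × E →L[ℝ] E) (v, w) :=
    (mfderiv_prod_eq_add_apply (v := (v, w)) hm).symm
  rw [e]
  exact (hg.prodMk hh).comp (F := fun p : G × G => p.1 * p.2) hm.hasMFDerivAt

theorem HasVelocityAt.exists_inv (hg : HasVelocityAt I g v t) :
    ∃ u, HasVelocityAt I (fun s => (g s)⁻¹) u t := by
  have hi : MDifferentiableAt I I (fun p : G => p⁻¹) (g t) :=
    (contMDiff_inv I ∞).mdifferentiableAt (by simp)
  exact ⟨_, hg.comp (F := fun p : G => p⁻¹) hi.hasMFDerivAt⟩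

theorem HasVelocityAt.leftTrans_mul (hg : HasVelocityAt I g (leftTrans I (g t) 1 ξ) t)
    (hh : HasVelocityAt I h v t) :
    HasVelocityAt I (fun s => g s * h s)
      (leftTrans I (g t) (h t) (rightTrans I (h t) 1 ξ + v)) t := by
  have e := DFunLike.congr_fun (rightTrans_comp_leftTrans I (g t) (h t) 1) ξ
  simp only [ContinuousLinearMap.comp_apply, mul_one, one_mul] at e
  simpa only [map_add, e] using hg.mul hh

theorem HasVelocityAt.leftTrans_inv_mul {γ : ℝ → G}
    (hg : HasVelocityAt I g (leftTrans I (g t) 1 ξ) t)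
    (hγ : HasVelocityAt I γ (leftTrans I (γ t) 1 ζ) t) :
    HasVelocityAt I (fun s => (g s)⁻¹ * γ s)
      (leftTrans I ((g t)⁻¹ * γ t) 1 ζ - rightTrans I ((g t)⁻¹ * γ t) 1 ξ) t := by
  obtain ⟨u, hu⟩ := hg.exists_inv
  obtain ⟨w, hw⟩ : ∃ w, HasVelocityAt I (fun s => (g s)⁻¹ * γ s) w t := ⟨_, hu.mul hγ⟩
  have hv := hg.leftTrans_mul hw
  simp only [mul_inv_cancel_left] at hv
  have e := DFunLike.congr_fun (LieSwitched.leftTrans_mul I (g t) ((g t)⁻¹ * γ t) 1) ζ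
  rw [mul_inv_cancel_left, mul_one, ContinuousLinearMap.comp_apply] at e
  have ew := leftTrans_injective I _ _ ((hv.unique hγ).trans e)
  rwa [← ew, add_sub_cancel_left]

end Translations

section Chart

variable {E : Type*} [NormedAddCommGroup E] [NormedSpace ℝ E]
  {H : Type*} [TopologicalSpace H] (I : ModelWithCorners ℝ E H)
  (G : Type*) [TopologicalSpace G] [ChartedSpace H G] [Group G]

/-- The inverse of the preferred chart at the identity, recentred to map `0` to the identity. It
plays the role of the exponential map: only its derivative at `0` matters. -/
def locExp (x : E) : G := (extChartAt I (1 : G)).symm (extChartAt I (1 : G) 1 + x)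

/-- The preferred chart at the identity, recentred to map the identity to `0`. -/
def locLog (h : G) : E := extChartAt I (1 : G) h - extChartAt I (1 : G) 1

/-- The set on which `locExp` inverts `locLog`. -/
def locTarget : Set E := {x | extChartAt I (1 : G) 1 + x ∈ (extChartAt I (1 : G)).target}

/-- The set on which `locLog` inverts `locExp`. -/
def locSource : Set G := (extChartAt I (1 : G)).source

/-- The derivative of `locLog` at `h`. -/
def dlog (h : G) : E →L[ℝ] E := mfderiv I 𝓘(ℝ, E) (locLog I G) h

/-- The derivative of `locExp` at `x`. -/
def dexp (x : E) : E →L[ℝ] E := mfderiv 𝓘(ℝ, E) I (locExp I G) x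

/-- The multiplication of `G` in the recentred chart at the identity. -/
def locMul (p : E × E) : E := locLog I G (locExp I G p.1 * locExp I G p.2)

/-- The left-invariant vector fields in the chart: `leftFrame I G x v` is the value at `x` of the
one that extends `v`. -/
def leftFrame (x : E) : E →L[ℝ] E := fderiv ℝ (fun y => locMul I G (x, y)) 0

/-- The right-invariant vector fields in the chart: `rightFrame I G x v` is the value at `x` of the
one that extends `v`. -/
def rightFrame (x : E) : E →L[ℝ] E := fderiv ℝ (fun y => locMul I G (y, x)) 0

theorem isOpen_locSource : IsOpen (locSource I G) := isOpen_extChartAt_source (1 : G)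

theorem isOpen_locTarget [I.Boundaryless] : IsOpen (locTarget I G) :=
  (isOpen_extChartAt_target (I := I) (1 : G)).preimage (by fun_prop)

theorem zero_mem_locTarget : (0 : E) ∈ locTarget I G := by simp [locTarget]

theorem one_mem_locSource : (1 : G) ∈ locSource I G := by simp [locSource]

theorem locExp_zero : locExp I G 0 = 1 := by simp [locExp]

theorem locLog_one : locLog I G 1 = 0 := by simp [locLog]

theorem locTarget_mem_nhds [I.Boundaryless] : locTarget I G ∈ 𝓝 (0 : E) :=
  (isOpen_locTarget I G).mem_nhds (zero_mem_locTarget I G)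

variable {I G} {x : E} {h : G}

theorem locLog_locExp (hx : x ∈ locTarget I G) : locLog I G (locExp I G x) = x := by
  rw [locLog, locExp, (extChartAt I (1 : G)).right_inv hx, add_sub_cancel_left]

theorem locExp_locLog (hh : h ∈ locSource I G) : locExp I G (locLog I G h) = h := by
  rw [locLog, locExp, add_sub_cancel, (extChartAt I (1 : G)).left_inv hh]

theorem locExp_mem (hx : x ∈ locTarget I G) : locExp I G x ∈ locSource I G :=
  (extChartAt I (1 : G)).map_target hx

theorem locLog_mem (hh : h ∈ locSource I G) : locLog I G h ∈ locTarget I G := by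
  rw [locTarget, mem_ofPred_eq, locLog, add_sub_cancel]
  exact (extChartAt I (1 : G)).map_source hh

variable [LieGroup I ∞ G]

theorem contMDiffOn_locExp : ContMDiffOn 𝓘(ℝ, E) I ∞ (locExp I G) (locTarget I G) :=
  (contMDiffOn_extChartAt_symm (I := I) (n := ∞) (1 : G)).comp
    (contDiff_const.add contDiff_id).contMDiff.contMDiffOn fun _ hx => hx

theorem isClosed_locExp_image_closedBall [ProperSpace E] [T2Space G] {r : ℝ}
    (hr : closedBall 0 r ⊆ locTarget I G) : IsClosed (locExp I G '' closedBall 0 r) :=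
  ((isCompact_closedBall (0 : E) r).image_of_continuousOn
    (contMDiffOn_locExp.continuousOn.mono hr)).isClosed

theorem contMDiffOn_locLog : ContMDiffOn I 𝓘(ℝ, E) ∞ (locLog I G) (locSource I G) := by
  have h : ContMDiffOn I 𝓘(ℝ, E) ∞ (extChartAt I (1 : G)) (locSource I G) := by
    rw [locSource, extChartAt_source]
    exact contMDiffOn_extChartAt
  exact h.sub contMDiffOn_const

theorem hasMFDerivAt_locLog (hh : h ∈ locSource I G) :
    HasMFDerivAt I 𝓘(ℝ, E) (locLog I G) h (dlog I G h : E →L[ℝ] E) :=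
  ((contMDiffOn_locLog.contMDiffAt ((isOpen_locSource I G).mem_nhds hh)).mdifferentiableAt
    (by simp)).hasMFDerivAt

theorem dlog_eq_mfderiv (hh : h ∈ locSource I G) :
    dlog I G h = (mfderiv I 𝓘(ℝ, E) (extChartAt I (1 : G)) h : E →L[ℝ] E) := by
  have : IsManifold I 1 G := .of_le (n := ∞) (by simp)
  rw [locSource, extChartAt_source] at hh
  have hchart := (mdifferentiableAt_extChartAt (I := I) hh).hasMFDerivAt
  have hsub : HasFDerivAt (fun y : E => y - extChartAt I (1 : G) 1)
      (ContinuousLinearMap.id ℝ E) (extChartAt I (1 : G) h) := (hasFDerivAt_id _).sub_const _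
  exact (HasMFDerivAt.comp h hsub.hasMFDerivAt hchart).mfderiv

variable (I G) in
theorem dlog_one : dlog I G 1 = ContinuousLinearMap.id ℝ E := by
  rw [dlog_eq_mfderiv (one_mem_locSource I G), mfderiv_extChartAt_self]
  rfl

variable [I.Boundaryless]

theorem hasMFDerivAt_locExp (hx : x ∈ locTarget I G) :
    HasMFDerivAt 𝓘(ℝ, E) I (locExp I G) x (dexp I G x : E →L[ℝ] E) :=
  ((contMDiffOn_locExp.contMDiffAt ((isOpen_locTarget I G).mem_nhds hx)).mdifferentiableAt
    (by simp)).hasMFDerivAt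

theorem dexp_comp_dlog (hx : x ∈ locTarget I G) :
    dexp I G x ∘L dlog I G (locExp I G x) = ContinuousLinearMap.id ℝ E := by
  have hcomp := hasMFDerivAt_comp_of_eq (hasMFDerivAt_locExp hx)
    (hasMFDerivAt_locLog (locExp_mem hx)) (locLog_locExp hx)
  have hid : HasMFDerivAt I I (fun y => locExp I G (locLog I G y)) (locExp I G x)
      (ContinuousLinearMap.id ℝ E) :=
    (hasMFDerivAt_id _).congr_of_eventuallyEq
      (eventually_of_mem ((isOpen_locSource I G).mem_nhds (locExp_mem hx))
        fun y hy => locExp_locLog hy)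
  exact hasMFDerivAt_unique hcomp hid

variable (I G) in
theorem dexp_zero : dexp I G 0 = ContinuousLinearMap.id ℝ E := by
  have h := dexp_comp_dlog (zero_mem_locTarget I G)
  rwa [locExp_zero, dlog_one, ContinuousLinearMap.comp_id] at h

theorem hasFDerivAt_comp_locExp_zero {V : Type*} [NormedAddCommGroup V] [NormedSpace ℝ V]
    {F : G → V} {A : E →L[ℝ] V} (hF : HasMFDerivAt I 𝓘(ℝ, V) F 1 A) :
    HasFDerivAt (fun y => F (locExp I G y)) A 0 := by
  have h := hasMFDerivAt_comp_of_eq hF (hasMFDerivAt_locExp (zero_mem_locTarget I G))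
    (locExp_zero I G)
  rw [dexp_zero, ContinuousLinearMap.comp_id] at h
  exact hasMFDerivAt_iff_hasFDerivAt.1 h

theorem leftFrame_eq_dlog_comp (hx : x ∈ locTarget I G) :
    leftFrame I G x = dlog I G (locExp I G x) ∘L leftTrans I (locExp I G x) 1 :=
  (hasFDerivAt_comp_locExp_zero <| hasMFDerivAt_comp_of_eq (hasMFDerivAt_locLog (locExp_mem hx))
    (hasMFDerivAt_leftTrans I (locExp I G x) 1) (mul_one _)).fderiv

theorem rightFrame_eq_dlog_comp (hx : x ∈ locTarget I G) :
    rightFrame I G x = dlog I G (locExp I G x) ∘L rightTrans I (locExp I G x) 1 :=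
  (hasFDerivAt_comp_locExp_zero <| hasMFDerivAt_comp_of_eq (hasMFDerivAt_locLog (locExp_mem hx))
    (hasMFDerivAt_rightTrans I (locExp I G x) 1) (one_mul _)).fderiv

variable (I G) in
theorem leftFrame_zero : leftFrame I G 0 = ContinuousLinearMap.id ℝ E := by
  rw [leftFrame_eq_dlog_comp (zero_mem_locTarget I G), locExp_zero, dlog_one, leftTrans_one,
    ContinuousLinearMap.comp_id]

variable (I G) in
theorem rightFrame_zero : rightFrame I G 0 = ContinuousLinearMap.id ℝ E := by
  rw [rightFrame_eq_dlog_comp (zero_mem_locTarget I G), locExp_zero, dlog_one, rightTrans_one,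
    ContinuousLinearMap.comp_id]

theorem contDiffAt_locMul {y : E} (hx : x ∈ locTarget I G) (hy : y ∈ locTarget I G)
    (hxy : locExp I G x * locExp I G y ∈ locSource I G) : ContDiffAt ℝ ∞ (locMul I G) (x, y) := by
  rw [← contMDiffAt_iff_contDiffAt]
  have hfst : ContMDiffAt 𝓘(ℝ, E × E) I ∞ (fun p : E × E => locExp I G p.1) (x, y) :=
    ContMDiffAt.comp (g := locExp I G) (f := Prod.fst) (x, y)
      (contMDiffOn_locExp.contMDiffAt ((isOpen_locTarget I G).mem_nhds hx))
      contDiff_fst.contMDiff.contMDiffAt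
  have hsnd : ContMDiffAt 𝓘(ℝ, E × E) I ∞ (fun p : E × E => locExp I G p.2) (x, y) :=
    ContMDiffAt.comp (g := locExp I G) (f := Prod.snd) (x, y)
      (contMDiffOn_locExp.contMDiffAt ((isOpen_locTarget I G).mem_nhds hy))
      contDiff_snd.contMDiff.contMDiffAt
  exact ContMDiffAt.comp (x, y)
    (contMDiffOn_locLog.contMDiffAt ((isOpen_locSource I G).mem_nhds hxy)) (hfst.mul hsnd)

theorem contDiffAt_locMul_prodMk_zero (hx : x ∈ locTarget I G) :
    ContDiffAt ℝ ∞ (locMul I G) (x, 0) :=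
  contDiffAt_locMul hx (zero_mem_locTarget I G) (by rw [locExp_zero, mul_one]; exact locExp_mem hx)

theorem contDiffAt_locMul_zero_prodMk (hx : x ∈ locTarget I G) :
    ContDiffAt ℝ ∞ (locMul I G) (0, x) :=
  contDiffAt_locMul (zero_mem_locTarget I G) hx (by rw [locExp_zero, one_mul]; exact locExp_mem hx)

theorem leftFrame_eq_fderiv_locMul (hx : x ∈ locTarget I G) :
    leftFrame I G x = fderiv ℝ (locMul I G) (x, 0) ∘L ContinuousLinearMap.inr ℝ E E := by
  have h := ((contDiffAt_locMul_prodMk_zero hx).differentiableAt (by simp)).hasFDerivAt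
  exact (HasFDerivAt.comp (g := locMul I G) (f := fun y => (x, y)) (0 : E) h
    (hasFDerivAt_prodMk_right x (0 : E))).fderiv

theorem rightFrame_eq_fderiv_locMul (hx : x ∈ locTarget I G) :
    rightFrame I G x = fderiv ℝ (locMul I G) (0, x) ∘L ContinuousLinearMap.inl ℝ E E := by
  have h := ((contDiffAt_locMul_zero_prodMk hx).differentiableAt (by simp)).hasFDerivAt
  exact (HasFDerivAt.comp (g := locMul I G) (f := fun y => (y, x)) (0 : E) h
    (hasFDerivAt_prodMk_left (0 : E) x)).fderiv

theorem contDiffOn_leftFrame : ContDiffOn ℝ ∞ (leftFrame I G) (locTarget I G) := by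
  intro x hx
  refine ContDiffWithinAt.congr (f := fun x => fderiv ℝ (locMul I G) (x, 0)
    ∘L ContinuousLinearMap.inr ℝ E E) ?_ (fun y hy => leftFrame_eq_fderiv_locMul hy)
    (leftFrame_eq_fderiv_locMul hx)
  have h := (contDiffAt_locMul_prodMk_zero hx).fderiv_right (m := ∞) (by simp)
  exact ((h.comp x (contDiffAt_id.prodMk contDiffAt_const)).clm_comp
    contDiffAt_const).contDiffWithinAt

theorem contDiffOn_rightFrame : ContDiffOn ℝ ∞ (rightFrame I G) (locTarget I G) := by
  intro x hx
  refine ContDiffWithinAt.congr (f := fun x => fderiv ℝ (locMul I G) (0, x)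
    ∘L ContinuousLinearMap.inl ℝ E E) ?_ (fun y hy => rightFrame_eq_fderiv_locMul hy)
    (rightFrame_eq_fderiv_locMul hx)
  have h := (contDiffAt_locMul_zero_prodMk hx).fderiv_right (m := ∞) (by simp)
  exact ((h.comp x (contDiffAt_const.prodMk contDiffAt_id)).clm_comp
    contDiffAt_const).contDiffWithinAt

variable (I G)

theorem differentiableAt_leftFrame_zero : DifferentiableAt ℝ (leftFrame I G) 0 :=
  (contDiffOn_leftFrame.contDiffAt (locTarget_mem_nhds I G)).differentiableAt (by simp)

theorem differentiableAt_rightFrame_zero : DifferentiableAt ℝ (rightFrame I G) 0 :=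
  (contDiffOn_rightFrame.contDiffAt (locTarget_mem_nhds I G)).differentiableAt (by simp)

theorem contDiffAt_locMul_zero : ContDiffAt ℝ ∞ (locMul I G) 0 :=
  contDiffAt_locMul_prodMk_zero (zero_mem_locTarget I G)

theorem differentiableAt_fderiv_locMul_zero :
    DifferentiableAt ℝ (fderiv ℝ (locMul I G)) 0 :=
  ((contDiffAt_locMul_zero I G).fderiv_right (m := ∞) (by simp)).differentiableAt (by simp)

theorem fderiv_leftFrame_zero (v w : E) : fderiv ℝ (leftFrame I G) 0 v w
    = fderiv ℝ (fderiv ℝ (locMul I G)) 0 (v, 0) (0, w) := by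
  have e : leftFrame I G =ᶠ[𝓝 0] fun x => fderiv ℝ (locMul I G)
      (ContinuousLinearMap.inl ℝ E E x) ∘L ContinuousLinearMap.inr ℝ E E :=
    eventually_of_mem (locTarget_mem_nhds I G) fun y hy => leftFrame_eq_fderiv_locMul hy
  rw [e.fderiv_eq, fderiv_comp_clm_comp_clm_zero (differentiableAt_fderiv_locMul_zero I G)]
  rfl

theorem fderiv_rightFrame_zero (v w : E) : fderiv ℝ (rightFrame I G) 0 v w
    = fderiv ℝ (fderiv ℝ (locMul I G)) 0 (0, v) (w, 0) := by
  have e : rightFrame I G =ᶠ[𝓝 0] fun x => fderiv ℝ (locMul I G)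
      (ContinuousLinearMap.inr ℝ E E x) ∘L ContinuousLinearMap.inl ℝ E E :=
    eventually_of_mem (locTarget_mem_nhds I G) fun y hy => rightFrame_eq_fderiv_locMul hy
  rw [e.fderiv_eq, fderiv_comp_clm_comp_clm_zero (differentiableAt_fderiv_locMul_zero I G)]
  rfl

theorem fderiv_rightFrame_zero_eq_fderiv_leftFrame_zero (v w : E) :
    fderiv ℝ (rightFrame I G) 0 v w = fderiv ℝ (leftFrame I G) 0 w v := by
  rw [fderiv_rightFrame_zero, fderiv_leftFrame_zero]
  refine (contDiffAt_locMul_zero I G).isSymmSndFDerivAt ?_ |>.eq _ _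
  rw [minSmoothness_of_isRCLikeNormedField]
  exact WithTop.coe_le_coe.2 (le_top : (2 : ℕ∞) ≤ ⊤)

theorem lieBracket_leftFrame_sub (c v w : E) :
    VectorField.lieBracket ℝ (fun y => leftFrame I G (y - c) v) (fun y => leftFrame I G (y - c) w) c
      = fderiv ℝ (leftFrame I G) 0 v w - fderiv ℝ (leftFrame I G) 0 w v := by
  have hfd : ∀ u z : E, fderiv ℝ (fun y => leftFrame I G (y - c) u) c z
      = fderiv ℝ (leftFrame I G) 0 z u := fun u z => by
    rw [fderiv_comp_sub (f := fun y => leftFrame I G y u), sub_self,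
      fderiv_clm_apply (differentiableAt_leftFrame_zero I G) (differentiableAt_const u)]
    simp
  simp only [VectorField.lieBracket, hfd, sub_self, leftFrame_zero, ContinuousLinearMap.id_apply]

variable {I G}

theorem mpullbackWithin_mulInvariantVectorField {y : E} (hy : y ∈ (extChartAt I (1 : G)).target)
    (v : GroupLieAlgebra I G) :
    VectorField.mpullbackWithin 𝓘(ℝ, E) I (extChartAt I (1 : G)).symm
      (mulInvariantVectorField v) (range I) y
      = (leftFrame I G (y - extChartAt I (1 : G) 1) (v : E) : E) := by
  have : IsManifold I 1 G := .of_le (n := ∞) (by simp)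
  have hx : y - extChartAt I (1 : G) 1 ∈ locTarget I G := by simpa [locTarget] using hy
  have e : locExp I G (y - extChartAt I (1 : G) 1) = (extChartAt I (1 : G)).symm y := by
    simp [locExp]
  rw [VectorField.mpullbackWithin_apply,
    ContinuousLinearMap.inverse_eq (mfderivWithin_extChartAt_symm_comp_mfderiv_extChartAt hy)
      (mfderiv_extChartAt_comp_mfderivWithin_extChartAt_symm hy),
    leftFrame_eq_dlog_comp hx, dlog_eq_mfderiv (locExp_mem hx), e]
  rfl

theorem bracket_eq_fderiv_leftFrame (v w : GroupLieAlgebra I G) :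
    ⁅v, w⁆ = (fderiv ℝ (leftFrame I G) 0 (v : E) (w : E)
      - fderiv ℝ (leftFrame I G) 0 (w : E) (v : E) : E) := by
  have : IsManifold I 1 G := .of_le (n := ∞) (by simp)
  have hpull : ∀ u : GroupLieAlgebra I G, (VectorField.mpullbackWithin 𝓘(ℝ, E) I
      (extChartAt I (1 : G)).symm (mulInvariantVectorField u) (range I) : E → E)
      =ᶠ[𝓝 (extChartAt I (1 : G) 1)]
        fun y => leftFrame I G (y - extChartAt I (1 : G) 1) (u : E) := fun u =>
    eventually_of_mem ((isOpen_extChartAt_target (I := I) (1 : G)).mem_nhds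
      (mem_extChartAt_target (1 : G))) fun y hy => mpullbackWithin_mulInvariantVectorField hy u
  have hinv : ((mfderiv I 𝓘(ℝ, E) (extChartAt I (1 : G)) 1).inverse : E →L[ℝ] E)
      = ContinuousLinearMap.id ℝ E := by
    rw [mfderiv_extChartAt_self]
    exact ContinuousLinearMap.inverse_id (R := ℝ) (M := E)
  have hbracket : ∀ {V W : E → E},
      V =ᶠ[𝓝 (extChartAt I (1 : G) 1)] (fun y => leftFrame I G (y - extChartAt I (1 : G) 1) v) →
      W =ᶠ[𝓝 (extChartAt I (1 : G) 1)] (fun y => leftFrame I G (y - extChartAt I (1 : G) 1) w) →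
      VectorField.lieBracketWithin ℝ V W ((extChartAt I (1 : G)).symm ⁻¹' univ ∩ range I)
        (extChartAt I (1 : G) 1)
        = fderiv ℝ (leftFrame I G) 0 v w - fderiv ℝ (leftFrame I G) 0 w v := fun hV hW => by
    rw [preimage_univ, univ_inter, ModelWithCorners.range_eq_univ,
      VectorField.lieBracketWithin_univ, hV.lieBracket_vectorField_eq hW]
    exact lieBracket_leftFrame_sub I G _ _ _
  rw [GroupLieAlgebra.bracket_def, ← VectorField.mlieBracketWithin_univ,
    VectorField.mlieBracketWithin_apply]
  exact (DFunLike.congr_fun hinv _).trans (hbracket (hpull v) (hpull w))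

end Chart

section Dynamics

variable {E : Type*} [NormedAddCommGroup E] [NormedSpace ℝ E]
  {H : Type*} [TopologicalSpace H] {I : ModelWithCorners ℝ E H} [I.Boundaryless]
  {G : Type*} [TopologicalSpace G] [ChartedSpace H G] [Group G] [LieGroup I ∞ G]
  {g γ : ℝ → G} {x : ℝ → E} {ξ ζ : E} {t : ℝ}

theorem hasDerivAt_locLog_inv_mul (hg : HasVelocityAt I g (leftTrans I (g t) 1 ξ) t)
    (hγ : HasVelocityAt I γ (leftTrans I (γ t) 1 ζ) t) (hmem : (g t)⁻¹ * γ t ∈ locSource I G) :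
    HasDerivAt (fun s => locLog I G ((g s)⁻¹ * γ s))
      (leftFrame I G (locLog I G ((g t)⁻¹ * γ t)) ζ
        - rightFrame I G (locLog I G ((g t)⁻¹ * γ t)) ξ) t := by
  have h := (hg.leftTrans_inv_mul hγ).comp (hasMFDerivAt_locLog hmem)
  rw [leftFrame_eq_dlog_comp (locLog_mem hmem), rightFrame_eq_dlog_comp (locLog_mem hmem),
    locExp_locLog hmem, ContinuousLinearMap.comp_apply, ContinuousLinearMap.comp_apply, ← map_sub]
  exact hasVelocityAt_iff_hasDerivAt.1 h

theorem hasVelocityAt_mul_locExp (hg : HasVelocityAt I g (leftTrans I (g t) 1 ξ) t)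
    (hmem : x t ∈ locTarget I G)
    (hx : HasDerivAt x (leftFrame I G (x t) ζ - rightFrame I G (x t) ξ) t) :
    HasVelocityAt I (fun s => g s * locExp I G (x s))
      (leftTrans I (g t * locExp I G (x t)) 1 ζ) t := by
  have hexp : dexp I G (x t) (leftFrame I G (x t) ζ - rightFrame I G (x t) ξ)
      = leftTrans I (locExp I G (x t)) 1 ζ - rightTrans I (locExp I G (x t)) 1 ξ := by
    rw [leftFrame_eq_dlog_comp hmem, rightFrame_eq_dlog_comp hmem,
      ContinuousLinearMap.comp_apply, ContinuousLinearMap.comp_apply, ← map_sub]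
    exact DFunLike.congr_fun (dexp_comp_dlog hmem) _
  have htrans := DFunLike.congr_fun (leftTrans_mul I (g t) (locExp I G (x t)) 1) ζ
  rw [mul_one, ContinuousLinearMap.comp_apply] at htrans
  have h := hg.leftTrans_mul
    ((hasVelocityAt_iff_hasDerivAt.2 hx).comp (hasMFDerivAt_locExp hmem))
  rwa [hexp, add_sub_cancel, ← htrans] at h

theorem hasVelocityAt_const_mul_locExp (a : G) (hmem : x t ∈ locTarget I G)
    (hx : HasDerivAt x (leftFrame I G (x t) ζ) t) :
    HasVelocityAt I (fun s => a * locExp I G (x s)) (leftTrans I (a * locExp I G (x t)) 1 ζ) t :=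
  hasVelocityAt_mul_locExp (g := fun _ => a) (ξ := 0)
    (by rw [map_zero]; exact hasVelocityAt_const I a t) hmem (by rwa [map_zero, sub_zero])

theorem hasDerivAt_locLog_const_mul (a : G) (hγ : HasVelocityAt I γ (leftTrans I (γ t) 1 ζ) t)
    (hmem : a⁻¹ * γ t ∈ locSource I G) :
    HasDerivAt (fun s => locLog I G (a⁻¹ * γ s)) (leftFrame I G (locLog I G (a⁻¹ * γ t)) ζ) t := by
  have h := hasDerivAt_locLog_inv_mul (g := fun _ => a) (ξ := 0)
    (by rw [map_zero]; exact hasVelocityAt_const I a t) hγ hmem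
  rwa [map_zero, sub_zero] at h

theorem hasVelocityAt_of_eventually_ne {ζ : ℝ → E} (hγ : ContinuousAt γ t) (hζ : ContinuousAt ζ t)
    (h : ∀ᶠ s in 𝓝[≠] t, HasVelocityAt I γ (leftTrans I (γ s) 1 (ζ s)) s) :
    HasVelocityAt I γ (leftTrans I (γ t) 1 (ζ t)) t := by
  have := topologicalGroup_of_lieGroup I ∞ (G := G)
  set y : ℝ → E := fun s => locLog I G ((γ t)⁻¹ * γ s) with hy
  have hyt : y t = 0 := by simp [hy, locLog_one]
  have hγc : ContinuousAt (fun s => (γ t)⁻¹ * γ s) t := continuousAt_const.mul hγ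
  have hmem : ∀ᶠ s in 𝓝 t, (γ t)⁻¹ * γ s ∈ locSource I G :=
    hγc.eventually_mem ((isOpen_locSource I G).mem_nhds
      (by rw [inv_mul_cancel]; exact one_mem_locSource I G))
  have hyc : ContinuousAt y t :=
    ContinuousAt.comp (f := fun s => (γ t)⁻¹ * γ s)
      (contMDiffOn_locLog.continuousOn.continuousAt
        ((isOpen_locSource I G).mem_nhds hmem.self_of_nhds)) hγc
  have hfield : ContinuousAt (fun s => leftFrame I G (y s) (ζ s)) t := by
    have hframe : ContinuousAt (leftFrame I G) (y t) := by
      rw [hyt]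
      exact (differentiableAt_leftFrame_zero I G).continuousAt
    exact (hframe.comp hyc).clm_apply hζ
  have hd : HasDerivAt y (leftFrame I G (y t) (ζ t)) t := by
    refine hasDerivAt_of_eventually_hasDerivAt_of_ne
      (g := fun s => leftFrame I G (y s) (ζ s)) ?_ hyc hfield
    filter_upwards [h, mem_nhdsWithin_of_mem_nhds hmem] with s hs hs'
    exact hasDerivAt_locLog_const_mul (γ t) hs hs'
  have hv := hasVelocityAt_const_mul_locExp (γ t) (by rw [hyt]; exact zero_mem_locTarget I G) hd
  rw [hyt, locExp_zero, mul_one] at hv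
  refine hv.congr_of_eventuallyEq ?_
  filter_upwards [hmem] with s hs
  rw [hy, locExp_locLog hs, mul_inv_cancel_left]

end Dynamics

section Trajectories

variable {E : Type*} [NormedAddCommGroup E] [NormedSpace ℝ E]
  {H : Type*} [TopologicalSpace H] {I : ModelWithCorners ℝ E H}
  {G : Type*} [TopologicalSpace G] [ChartedSpace H G] [Group G]
  {n : ℕ} {t₀ t₁ r : ℝ} {g₀ : G} {f : Fin (n + 1) → G → ℝ → GroupLieAlgebra I G}
  {T T' : Fin n → ℝ} {g γ : ℝ → G} {x : ℝ → E}

/-- The `k`-th mode, with `𝔤` identified with its model space `E`. -/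
def modeCoord (f : Fin (n + 1) → G → ℝ → GroupLieAlgebra I G) (k : Fin (n + 1)) (a : G) (t : ℝ) :
    E := f k a t

/-- The switched field, with `𝔤` identified with its model space `E`. -/
def switchedCoord (f : Fin (n + 1) → G → ℝ → GroupLieAlgebra I G) (t₀ t₁ : ℝ) (T : Fin n → ℝ)
    (a : G) (t : ℝ) : E := ∑ k, modeWeight t₀ t₁ T k t • modeCoord f k a t

/-- The `k`-th mode as a field in the chart along `g`: at `x` it is the left-invariant field whose
value at the identity is the mode at `g t * locExp x`. -/
def leftMode (f : Fin (n + 1) → G → ℝ → GroupLieAlgebra I G) (g : ℝ → G) (k : Fin (n + 1)) (t : ℝ)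
    (x : E) : E := leftFrame I G x (modeCoord f k (g t * locExp I G x) t)

/-- The right-invariant field, in the chart, whose value at the identity is the `k`-th mode at
`g t`. Subtracting it accounts for the motion of the base point `g t`. -/
def rightMode (f : Fin (n + 1) → G → ℝ → GroupLieAlgebra I G) (g : ℝ → G) (k : Fin (n + 1)) (t : ℝ)
    (x : E) : E := rightFrame I G x (modeCoord f k (g t) t)

theorem deviationField_leftMode_rightMode (f : Fin (n + 1) → G → ℝ → GroupLieAlgebra I G)
    (g : ℝ → G) (T T' : Fin n → ℝ) (t : ℝ) (x : E) :
    deviationField t₀ t₁ (leftMode f g) (rightMode f g) T T' t x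
      = leftFrame I G x (switchedCoord f t₀ t₁ T' (g t * locExp I G x) t)
        - rightFrame I G x (switchedCoord f t₀ t₁ T (g t) t) := by
  simp only [deviationField, leftMode, rightMode, switchedCoord, map_sum, map_smul,
    Finset.sum_sub_distrib]

theorem hasVelocityAt_of_isTrajectory (h : IsTrajectory f t₀ t₁ g₀ T γ) {t : ℝ}
    (ht : t ∈ Icc t₀ t₁) (htT : t ∉ range (times t₀ t₁ T)) :
    HasVelocityAt I γ (leftTrans I (γ t) 1 (switchedCoord f t₀ t₁ T (γ t) t)) t :=
  h.ode t ht htT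

theorem mem_Ioo_of_notMem_range_times {t : ℝ} (ht : t ∈ Icc t₀ t₁)
    (htT : t ∉ range (times t₀ t₁ T)) : t ∈ Ioo t₀ t₁ := by
  refine ⟨lt_of_le_of_ne ht.1 fun h => htT ⟨0, ?_⟩, lt_of_le_of_ne ht.2 fun h =>
    htT ⟨Fin.last (n + 1), ?_⟩⟩
  · rw [times_zero, h]
  · rw [times_last, h]

theorem continuousOn_modeCoord_comp {k : Fin (n + 1)}
    (hf : ContinuousOn (fun p : G × ℝ => modeCoord f k p.1 p.2) (univ ×ˢ Icc t₀ t₁))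
    (hγ : ContinuousOn γ (Icc t₀ t₁)) :
    ContinuousOn (fun s => modeCoord f k (γ s) s) (Icc t₀ t₁) :=
  hf.comp (f := fun s => (γ s, s)) (hγ.prodMk continuousOn_id) fun _ hs => ⟨mem_univ _, hs⟩

theorem continuousAt_switchedCoord
    (hf : ∀ k, ContinuousOn (fun p : G × ℝ => modeCoord f k p.1 p.2) (univ ×ˢ Icc t₀ t₁))
    (hγ : ContinuousOn γ (Icc t₀ t₁)) {t : ℝ} (ht : t ∈ Icc t₀ t₁)
    (htT : t ∉ range (times t₀ t₁ T)) :
    ContinuousAt (fun s => switchedCoord f t₀ t₁ T (γ s) s) t := by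
  have ht' := mem_Ioo_of_notMem_range_times ht htT
  exact tendsto_finsetSum _ fun k _ => (continuousAt_modeWeight htT k).smul
    ((continuousOn_modeCoord_comp (hf k) hγ).continuousAt (Icc_mem_nhds ht'.1 ht'.2))

theorem eventually_nhdsNE_notMem_range_times (T : Fin n → ℝ) (t : ℝ) :
    ∀ᶠ s in 𝓝[≠] t, s ∉ range (times t₀ t₁ T) := by
  have hfin : (range (times t₀ t₁ T) \ {t}).Finite := (finite_range _).sdiff
  filter_upwards [mem_nhdsWithin_of_mem_nhds (hfin.isClosed.isOpen_compl.mem_nhds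
    fun h => h.2 rfl), self_mem_nhdsWithin] with s hs hst hsT
  exact hs ⟨hsT, hst⟩

theorem cost_eq_curveCost {L φ : G → ℝ} (h01 : t₀ ≤ t₁) (hγ : IsTrajectory f t₀ t₁ g₀ T γ)
    (huniq : ∀ γ', IsTrajectory f t₀ t₁ g₀ T γ' → EqOn γ' γ (Icc t₀ t₁)) :
    cost f t₀ t₁ g₀ L φ T = curveCost t₀ t₁ L φ γ := by
  have h : ∃ γ, IsTrajectory f t₀ t₁ g₀ T γ := ⟨γ, hγ⟩
  have he := huniq _ h.choose_spec
  rw [cost, dif_pos h, curveCost, curveCost, he (right_mem_Icc.2 h01),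
    integral_congr_Icc h01 fun s hs => congrArg L (he hs)]

variable [LieGroup I ∞ G] [I.Boundaryless]

theorem isTrajectory_mul_locExp [CompleteSpace E]
    (hf : ∀ k, ContinuousOn (fun p : G × ℝ => modeCoord f k p.1 p.2) (univ ×ˢ Icc t₀ t₁))
    (h01 : t₀ ≤ t₁) {DP DQ : Fin (n + 1) → ℝ → E →L[ℝ] E}
    (hsys : IsDeviationSystem t₀ t₁ r (leftMode f g) (rightMode f g) DP DQ)
    (hr : closedBall 0 r ⊆ locTarget I G) (hg : IsTrajectory f t₀ t₁ g₀ T g)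
    (hx : IsCaratheodorySolution (deviationField t₀ t₁ (leftMode f g) (rightMode f g) T T')
      t₀ t₁ r x) :
    IsTrajectory f t₀ t₁ g₀ T' (fun t => g t * locExp I G (x t)) := by
  have := topologicalGroup_of_lieGroup I ∞ (G := G)
  obtain ⟨K, hK⟩ := hsys.exists_isCaratheodory h01
  have hxU : MapsTo x (Icc t₀ t₁) (locTarget I G) := fun t ht => hr (hx.mapsTo ht)
  have hγc : ContinuousOn (fun t => g t * locExp I G (x t)) (Icc t₀ t₁) :=
    hg.continuousOn.mul (contMDiffOn_locExp.continuousOn.comp hx.continuousOn hxU)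
  refine ⟨?_, hγc, fun t ht htT => ?_⟩
  · have hx0 : x t₀ = 0 := by
      rw [hx.eq_integral t₀ (left_mem_Icc.2 h01), intervalIntegral.integral_same]
    simp only [hx0, locExp_zero, mul_one, hg.init]
  · have ht' := mem_Ioo_of_notMem_range_times ht htT
    refine hasVelocityAt_of_eventually_ne
      (ζ := fun s => switchedCoord f t₀ t₁ T' (g s * locExp I G (x s)) s)
      (hγc.continuousAt (Icc_mem_nhds ht'.1 ht'.2))
      (continuousAt_switchedCoord hf hγc ht htT) ?_
    filter_upwards [eventually_nhdsNE_notMem_range_times T t,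
      eventually_nhdsNE_notMem_range_times T' t,
      mem_nhdsWithin_of_mem_nhds (Ioo_mem_nhds ht'.1 ht'.2)] with s hsT hsT' hs
    have hs' := Ioo_subset_Icc_self hs
    have hd := (hK T T').hasDerivAt_solution hx hs
      (hsys.continuousAt hx.continuousOn hx.mapsTo hs hsT hsT')
    rw [deviationField_leftMode_rightMode] at hd
    exact hasVelocityAt_mul_locExp (hasVelocityAt_of_isTrajectory hg hs' hsT) (hxU hs') hd

theorem isCaratheodorySolution_locLog_inv_mul [CompleteSpace E]
    {DP DQ : Fin (n + 1) → ℝ → E →L[ℝ] E}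
    (hsys : IsDeviationSystem t₀ t₁ r (leftMode f g) (rightMode f g) DP DQ)
    (hg : IsTrajectory f t₀ t₁ g₀ T g) (hγ : IsTrajectory f t₀ t₁ g₀ T' γ) {b : ℝ}
    (hb : b ∈ Icc t₀ t₁) (hmem : MapsTo (fun t => (g t)⁻¹ * γ t) (Icc t₀ b)
      (locSource I G ∩ locLog I G ⁻¹' closedBall 0 r)) :
    IsCaratheodorySolution (deviationField t₀ t₁ (leftMode f g) (rightMode f g) T T') t₀ b r
      (fun t => locLog I G ((g t)⁻¹ * γ t)) := by
  have := topologicalGroup_of_lieGroup I ∞ (G := G)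
  have hsub : Icc t₀ b ⊆ Icc t₀ t₁ := Icc_subset_Icc_right hb.2
  obtain ⟨K, hK⟩ := hsys.exists_isCaratheodory (hb.1.trans hb.2)
  refine ((hK T T').mono hb).isCaratheodorySolution_of_hasDerivAt
    (S := range (times t₀ t₁ T) ∪ range (times t₀ t₁ T'))
    (contMDiffOn_locLog.continuousOn.comp ((hg.continuousOn.inv.mul hγ.continuousOn).mono hsub)
      fun t ht => (hmem ht).1) (fun t ht => (hmem ht).2) ?_
    ((countable_range _).union (countable_range _)) fun s hs hsT => ?_
  · rw [hg.init, hγ.init, inv_mul_cancel, locLog_one]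
  · have hs' := Ioo_subset_Icc_self hs
    have hd := hasDerivAt_locLog_inv_mul
      (hasVelocityAt_of_isTrajectory hg (hsub hs') fun h => hsT (Or.inl h))
      (hasVelocityAt_of_isTrajectory hγ (hsub hs') fun h => hsT (Or.inr h)) (hmem hs').1
    rwa [deviationField_leftMode_rightMode, locExp_locLog (hmem hs').1, mul_inv_cancel_left]

theorem eventually_mapsTo_inv_mul_trajectory [CompleteSpace E] [ProperSpace E] [T2Space G]
    (h01 : t₀ ≤ t₁) {DP DQ : Fin (n + 1) → ℝ → E →L[ℝ] E}
    (hsys : IsDeviationSystem t₀ t₁ r (leftMode f g) (rightMode f g) DP DQ)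
    (hr : closedBall 0 r ⊆ locTarget I G) (hg : IsTrajectory f t₀ t₁ g₀ T g) :
    ∀ᶠ T' in 𝓝 T, ∀ γ, IsTrajectory f t₀ t₁ g₀ T' γ → MapsTo (fun t => (g t)⁻¹ * γ t)
      (Icc t₀ t₁) (locSource I G ∩ locLog I G ⁻¹' closedBall 0 r) := by
  have := topologicalGroup_of_lieGroup I ∞ (G := G)
  obtain ⟨C, hC⟩ := hsys.exists_norm_solution_le h01
  have hr2 : closedBall (0 : E) (r / 2) ⊆ locTarget I G :=
    (closedBall_subset_closedBall (half_le_self hsys.pos.le)).trans hr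
  have hKW : locExp I G '' closedBall 0 (r / 2) ⊆ locSource I G ∩ locLog I G ⁻¹' ball 0 r := by
    rintro _ ⟨x, hx, rfl⟩
    refine ⟨locExp_mem (hr2 hx), ?_⟩
    rw [mem_preimage, locLog_locExp (hr2 hx)]
    exact closedBall_subset_ball (half_lt_self hsys.pos) hx
  have hWr : locSource I G ∩ locLog I G ⁻¹' ball 0 r
      ⊆ locSource I G ∩ locLog I G ⁻¹' closedBall 0 r :=
    inter_subset_inter_right _ (preimage_mono ball_subset_closedBall)
  have hlim : Tendsto (fun T' => C * ‖T' - T‖) (𝓝 T) (𝓝 0) := by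
    simpa using (tendsto_norm_sub_self T).const_mul C
  filter_upwards [hlim.eventually_le_const (half_pos hsys.pos)] with T' hT' γ hγ
  refine ((mapsTo_of_confined (hg.continuousOn.inv.mul hγ.continuousOn)
    (isClosed_locExp_image_closedBall hr2)
    (contMDiffOn_locLog.continuousOn.isOpen_inter_preimage (isOpen_locSource I G) isOpen_ball)
    hKW ⟨0, by simpa using (half_pos hsys.pos).le, ?_⟩ fun c hc hcW => ?_).mono_right
      hKW).mono_right hWr
  · rw [locExp_zero, Pi.mul_apply, Pi.inv_apply, hg.init, hγ.init, inv_mul_cancel]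
  · have hsol := isCaratheodorySolution_locLog_inv_mul hsys hg hγ hc (hcW.mono_right hWr)
    have hcc := right_mem_Icc.2 hc.1
    refine ⟨_, ?_, locExp_locLog (hcW hcc).1⟩
    exact mem_closedBall_zero_iff.2 ((hC T T' c hc _ hsol c hcc).trans hT')

theorem eventually_existsUnique_trajectory [CompleteSpace E] [ProperSpace E] [T2Space G]
    (hf : ∀ k, ContinuousOn (fun p : G × ℝ => modeCoord f k p.1 p.2) (univ ×ˢ Icc t₀ t₁))
    (h01 : t₀ ≤ t₁) {DP DQ : Fin (n + 1) → ℝ → E →L[ℝ] E}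
    (hsys : IsDeviationSystem t₀ t₁ r (leftMode f g) (rightMode f g) DP DQ)
    (hr : closedBall 0 r ⊆ locTarget I G) (hg : IsTrajectory f t₀ t₁ g₀ T g) :
    ∀ᶠ T' in 𝓝 T, ∃ x : ℝ → E,
      IsCaratheodorySolution (deviationField t₀ t₁ (leftMode f g) (rightMode f g) T T')
        t₀ t₁ r x ∧
      IsTrajectory f t₀ t₁ g₀ T' (fun t => g t * locExp I G (x t)) ∧
      ∀ γ, IsTrajectory f t₀ t₁ g₀ T' γ →
        EqOn γ (fun t => g t * locExp I G (x t)) (Icc t₀ t₁) := by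
  obtain ⟨K, hK⟩ := hsys.exists_isCaratheodory h01
  filter_upwards [hsys.eventually_exists_solution h01 T,
    eventually_mapsTo_inv_mul_trajectory h01 hsys hr hg] with T' ⟨x, hx⟩ hconf
  refine ⟨x, hx, isTrajectory_mul_locExp hf h01 hsys hr hg hx, fun γ hγ t ht => ?_⟩
  have hy := isCaratheodorySolution_locLog_inv_mul hsys hg hγ (right_mem_Icc.2 h01) (hconf γ hγ)
  have hxy : x t = locLog I G ((g t)⁻¹ * γ t) := (hK T T').eqOn_solution hx hy ht
  simp only [hxy, locExp_locLog (hconf γ hγ ht).1, mul_inv_cancel_left]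

end Trajectories

section LeftTrivialization

variable {E : Type*} [NormedAddCommGroup E] [NormedSpace ℝ E]
  {H : Type*} [TopologicalSpace H] {I : ModelWithCorners ℝ E H}
  {G : Type*} [TopologicalSpace G] [ChartedSpace H G] [Group G]
  {V : Type*} [NormedAddCommGroup V] [NormedSpace ℝ V]

variable (I) in
/-- The left-trivialized derivative `leftDeriv I F a` as a continuous linear map on the model space
`E` of `𝔤`. -/
def leftDerivCoord (F : G → V) (a : G) : E →L[ℝ] V :=
  (mfderiv I 𝓘(ℝ, V) F a : E →L[ℝ] V) ∘L leftTrans I a 1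

variable [I.Boundaryless] [LieGroup I ∞ G]

theorem hasFDerivAt_comp_mul_locExp {F : G → V} {a : G} (hF : MDifferentiableAt I 𝓘(ℝ, V) F a) :
    HasFDerivAt (fun x => F (a * locExp I G x)) (leftDerivCoord I F a) 0 :=
  hasFDerivAt_comp_locExp_zero
    (hasMFDerivAt_comp_of_eq hF.hasMFDerivAt (hasMFDerivAt_leftTrans I a 1) (mul_one a))

theorem hasFDerivAt_leftFrame_comp_mul_locExp {F : G → E} {a : G}
    (hF : MDifferentiableAt I 𝓘(ℝ, E) F a) :
    HasFDerivAt (fun x => leftFrame I G x (F (a * locExp I G x)))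
      (leftDerivCoord I F a + (fderiv ℝ (leftFrame I G) 0).flip (F a)) 0 := by
  have h := (differentiableAt_leftFrame_zero I G).hasFDerivAt.clm_apply
    (hasFDerivAt_comp_mul_locExp hF)
  rwa [leftFrame_zero, locExp_zero, mul_one, ContinuousLinearMap.id_comp] at h

variable (I G) in
theorem hasFDerivAt_rightFrame_apply (v : E) :
    HasFDerivAt (fun x => rightFrame I G x v) (fderiv ℝ (leftFrame I G) 0 v) 0 := by
  refine ((differentiableAt_rightFrame_zero I G).hasFDerivAt.clm_apply
    (hasFDerivAt_const v (0 : E))).congr_fderiv ?_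
  ext w
  simp [fderiv_rightFrame_zero_eq_fderiv_leftFrame_zero]

theorem fderiv_leftFrame_sub_rightFrame {F : G → GroupLieAlgebra I G} {a : G}
    (hF : MDifferentiableAt I 𝓘(ℝ, E) (M' := E) F a) (η : GroupLieAlgebra I G) :
    fderiv ℝ (fun x => leftFrame I G x (F (a * locExp I G x)) - rightFrame I G x (F a)) 0 (η : E)
      = (leftDerivLie F a η - ⁅F a, η⁆ : GroupLieAlgebra I G) := by
  have hbracket := bracket_eq_fderiv_leftFrame (F a) η
  obtain ⟨F', rfl⟩ : ∃ F' : G → E, F' = F := ⟨F, rfl⟩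
  have h := (hasFDerivAt_leftFrame_comp_mul_locExp hF).fun_sub
    (hasFDerivAt_rightFrame_apply I G (F' a))
  have hv : ∀ v : E,
      fderiv ℝ (fun x => leftFrame I G x (F' (a * locExp I G x)) - rightFrame I G x (F' a)) 0 v
        = leftDerivCoord I F' a v
          - (fderiv ℝ (leftFrame I G) 0 (F' a) v - fderiv ℝ (leftFrame I G) 0 v (F' a)) :=
    fun v => by
      rw [h.fderiv]
      simp only [sub_apply, add_apply, ContinuousLinearMap.flip_apply]
      abel
  exact (hv η).trans (congrArg (leftDerivCoord I F' a η - ·) hbracket.symm)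

end LeftTrivialization

section ModeDerivatives

variable {E : Type*} [NormedAddCommGroup E] [NormedSpace ℝ E]
  {H : Type*} [TopologicalSpace H] {I : ModelWithCorners ℝ E H}
  {G : Type*} [TopologicalSpace G] [ChartedSpace H G] [Group G]
  {n : ℕ} {t₀ t₁ : ℝ} {f : Fin (n + 1) → G → ℝ → GroupLieAlgebra I G} {g : ℝ → G}

/-- The derivative at `x = 0` of `leftMode`. -/
def leftModeDeriv (f : Fin (n + 1) → G → ℝ → GroupLieAlgebra I G) (g : ℝ → G) (k : Fin (n + 1))
    (t : ℝ) : E →L[ℝ] E := fderiv ℝ (leftMode f g k t) 0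

/-- The derivative at `x = 0` of `rightMode`. -/
def rightModeDeriv (f : Fin (n + 1) → G → ℝ → GroupLieAlgebra I G) (g : ℝ → G) (k : Fin (n + 1))
    (t : ℝ) : E →L[ℝ] E := fderiv ℝ (rightMode f g k t) 0

theorem contMDiff_modeCoord {k : Fin (n + 1)}
    (hf : ContMDiffOn (I.prod 𝓘(ℝ, ℝ)) 𝓘(ℝ, E) 1 (fun p : G × ℝ => modeCoord f k p.1 p.2)
      (univ ×ˢ Icc t₀ t₁)) {t : ℝ} (ht : t ∈ Icc t₀ t₁) :
    ContMDiff I 𝓘(ℝ, E) 1 (fun a => modeCoord f k a t) := by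
  rw [← contMDiffOn_univ]
  exact hf.comp (f := fun a : G => (a, t)) (contMDiff_id.prodMk contMDiff_const).contMDiffOn
    fun a _ => ⟨mem_univ _, ht⟩

variable [LieGroup I ∞ G]

theorem contMDiffOn_mul_locExp {E' H' : Type*} [NormedAddCommGroup E'] [NormedSpace ℝ E']
    [TopologicalSpace H'] {J : ModelWithCorners ℝ E' H'} {N : Type*} [TopologicalSpace N]
    [ChartedSpace H' N] {c : N → G} (hc : ContMDiff J I 1 c) (S : Set N) :
    ContMDiffOn (J.prod 𝓘(ℝ, E)) I 1 (fun p : N × E => c p.1 * locExp I G p.2)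
      (S ×ˢ locTarget I G) :=
  (hc.comp contMDiff_fst).contMDiffOn.mul
    ((contMDiffOn_locExp.of_le (by simp)).comp contMDiff_snd.contMDiffOn fun _ hp => hp.2)

variable [I.Boundaryless]

theorem leftMode_zero (k : Fin (n + 1)) (t : ℝ) :
    leftMode f g k t 0 = modeCoord f k (g t) t := by
  rw [leftMode, leftFrame_zero, locExp_zero, mul_one, ContinuousLinearMap.id_apply]

theorem rightMode_zero (k : Fin (n + 1)) (t : ℝ) :
    rightMode f g k t 0 = modeCoord f k (g t) t := by
  rw [rightMode, rightFrame_zero, ContinuousLinearMap.id_apply]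

theorem hasFDerivAt_leftMode_zero {k : Fin (n + 1)}
    (hf : ContMDiffOn (I.prod 𝓘(ℝ, ℝ)) 𝓘(ℝ, E) 1 (fun p : G × ℝ => modeCoord f k p.1 p.2)
      (univ ×ˢ Icc t₀ t₁)) {t : ℝ} (ht : t ∈ Icc t₀ t₁) :
    HasFDerivAt (leftMode f g k t) (leftModeDeriv f g k t) 0 :=
  (hasFDerivAt_leftFrame_comp_mul_locExp
    ((contMDiff_modeCoord hf ht).mdifferentiableAt one_ne_zero)).differentiableAt.hasFDerivAt

theorem hasFDerivAt_rightMode_zero (k : Fin (n + 1)) (t : ℝ) :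
    HasFDerivAt (rightMode f g k t) (rightModeDeriv f g k t) 0 :=
  (hasFDerivAt_rightFrame_apply I G (modeCoord f k (g t) t)).differentiableAt.hasFDerivAt

theorem deviationLinearization_apply
    (hf : ∀ k, ContMDiffOn (I.prod 𝓘(ℝ, ℝ)) 𝓘(ℝ, E) 1 (fun p : G × ℝ => modeCoord f k p.1 p.2)
      (univ ×ˢ Icc t₀ t₁)) (T : Fin n → ℝ) {t : ℝ} (ht : t ∈ Icc t₀ t₁)
    (η : GroupLieAlgebra I G) :
    deviationLinearization t₀ t₁ (leftModeDeriv f g) (rightModeDeriv f g) T t (η : E)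
      = (leftDerivLie (fun a => switchedField f t₀ t₁ T a t) (g t) η
        - ⁅switchedField f t₀ t₁ T (g t) t, η⁆ : GroupLieAlgebra I G) := by
  have hF : ContMDiff I 𝓘(ℝ, E) 1 (fun a => switchedCoord f t₀ t₁ T a t) :=
    contMDiff_finsetSum fun k _ => (contMDiff_const (c := modeWeight t₀ t₁ T k t)
      (I' := 𝓘(ℝ, ℝ))).smul (contMDiff_modeCoord (hf k) ht)
  refine Eq.trans ?_ (fderiv_leftFrame_sub_rightFrame
    (F := fun a => switchedField f t₀ t₁ T a t) (hF.mdifferentiableAt one_ne_zero) η)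
  rw [← (hasFDerivAt_deviationField (fun k => hasFDerivAt_leftMode_zero (hf k) ht)
    (fun k => hasFDerivAt_rightMode_zero k t) t₀ t₁ T).fderiv,
    funext (deviationField_leftMode_rightMode f g T T t)]
  rfl

variable [ProperSpace E] {r R : ℝ}

theorem uniformC1_leftMode {k : Fin (n + 1)}
    (hf : ContMDiffOn (I.prod 𝓘(ℝ, ℝ)) 𝓘(ℝ, E) 1 (fun p : G × ℝ => modeCoord f k p.1 p.2)
      (univ ×ˢ Icc t₀ t₁)) (hg : ContinuousOn g (Icc t₀ t₁)) (hr : 0 < r) (hrR : r < R)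
    (hRU : ball 0 R ⊆ locTarget I G) :
    UniformC1 t₀ t₁ r (leftMode f g k) (leftModeDeriv f g k) := by
  have : IsManifold I 1 G := .of_le (n := ∞) (by simp)
  have hmode : ContMDiffOn ((I.prod 𝓘(ℝ, ℝ)).prod 𝓘(ℝ, E)) 𝓘(ℝ, E) 1
      (fun p : (G × ℝ) × E => modeCoord f k (p.1.1 * locExp I G p.2) p.1.2)
      ((univ ×ˢ Icc t₀ t₁) ×ˢ locTarget I G) :=
    hf.comp ((contMDiffOn_mul_locExp contMDiff_fst _).prodMk
      (contMDiff_snd.comp contMDiff_fst).contMDiffOn) fun p hp => ⟨mem_univ _, hp.1.2⟩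
  exact UniformC1.of_contMDiffOn (S := univ ×ˢ Icc t₀ t₁) (c := fun t => (g t, t))
    (Φ := fun (p : G × ℝ) x => leftFrame I G x (modeCoord f k (p.1 * locExp I G x) p.2))
    (isOpen_locTarget I G)
    (contMDiffOn_clm_apply_snd (contDiffOn_leftFrame.of_le (by simp)) hmode)
    hr hrR hRU (hg.prodMk continuousOn_id) fun t ht => ⟨mem_univ _, ht⟩

theorem uniformC1_rightMode {k : Fin (n + 1)}
    (hf : ContMDiffOn (I.prod 𝓘(ℝ, ℝ)) 𝓘(ℝ, E) 1 (fun p : G × ℝ => modeCoord f k p.1 p.2)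
      (univ ×ˢ Icc t₀ t₁)) (hg : ContinuousOn g (Icc t₀ t₁)) (hr : 0 < r) (hrR : r < R)
    (hRU : ball 0 R ⊆ locTarget I G) :
    UniformC1 t₀ t₁ r (rightMode f g k) (rightModeDeriv f g k) := by
  have : IsManifold I 1 G := .of_le (n := ∞) (by simp)
  exact UniformC1.of_contMDiffOn (S := univ ×ˢ Icc t₀ t₁) (c := fun t => (g t, t))
    (Φ := fun (p : G × ℝ) x => rightFrame I G x (modeCoord f k p.1 p.2))
    (isOpen_locTarget I G) (contMDiffOn_clm_apply_snd (contDiffOn_rightFrame.of_le (by simp))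
      (hf.comp contMDiff_fst.contMDiffOn fun p hp => hp.1))
    hr hrR hRU (hg.prodMk continuousOn_id) fun t ht => ⟨mem_univ _, ht⟩

theorem uniformC1_comp_mul_locExp {V : Type*} [NormedAddCommGroup V] [NormedSpace ℝ V] {F : G → V}
    (hF : ContMDiff I 𝓘(ℝ, V) 1 F) (hg : ContinuousOn g (Icc t₀ t₁)) (hr : 0 < r) (hrR : r < R)
    (hRU : ball 0 R ⊆ locTarget I G) :
    UniformC1 t₀ t₁ r (fun t x => F (g t * locExp I G x)) (fun t => leftDerivCoord I F (g t)) := by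
  have : IsManifold I 1 G := .of_le (n := ∞) (by simp)
  have h := UniformC1.of_contMDiffOn (Φ := fun (a : G) x => F (a * locExp I G x))
    (isOpen_locTarget I G) (hF.comp_contMDiffOn (contMDiffOn_mul_locExp contMDiff_id univ))
    hr hrR hRU hg (mapsTo_univ _ _)
  simpa only [fun t => (hasFDerivAt_comp_mul_locExp
    (hF.mdifferentiableAt (x := g t) one_ne_zero)).fderiv] using h

theorem exists_isDeviationSystem
    (hf : ∀ k, ContMDiffOn (I.prod 𝓘(ℝ, ℝ)) 𝓘(ℝ, E) 1 (fun p : G × ℝ => modeCoord f k p.1 p.2)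
      (univ ×ˢ Icc t₀ t₁)) {L : G → ℝ} (hL : ContMDiff I 𝓘(ℝ, ℝ) 1 L)
    (hg : ContinuousOn g (Icc t₀ t₁)) :
    ∃ r, closedBall 0 r ⊆ locTarget I G ∧
      IsDeviationSystem t₀ t₁ r (leftMode f g) (rightMode f g) (leftModeDeriv f g)
        (rightModeDeriv f g) ∧
      UniformC1 t₀ t₁ r (fun t x => L (g t * locExp I G x))
        (fun t => leftDerivCoord I L (g t)) := by
  obtain ⟨R, hR, hRU⟩ := Metric.isOpen_iff.1 (isOpen_locTarget I G) 0 (zero_mem_locTarget I G)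
  have hr := half_pos hR
  have hrR := half_lt_self hR
  exact ⟨R / 2, (closedBall_subset_ball hrR).trans hRU,
    ⟨hr, fun k => uniformC1_leftMode (hf k) hg hr hrR hRU,
      fun k => uniformC1_rightMode (hf k) hg hr hrR hRU,
      fun k t _ => (leftMode_zero k t).trans (rightMode_zero k t).symm⟩,
    uniformC1_comp_mul_locExp hL hg hr hrR hRU⟩

end ModeDerivatives

section Costate

variable {E : Type*} [NormedAddCommGroup E] [NormedSpace ℝ E] [FiniteDimensional ℝ E]
  {H : Type*} [TopologicalSpace H] {I : ModelWithCorners ℝ E H}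
  {G : Type*} [TopologicalSpace G] [ChartedSpace H G] [Group G]
  {n : ℕ} {t₀ t₁ r : ℝ} {g₀ : G} {f : Fin (n + 1) → G → ℝ → GroupLieAlgebra I G}
  {L φ : G → ℝ} {T : Fin n → ℝ} {g : ℝ → G} {ρ : ℝ → Module.Dual ℝ (GroupLieAlgebra I G)}

/-- A covector on `𝔤` as a continuous linear form on the model space `E` of `𝔤`. -/
def dualCoord (α : Module.Dual ℝ (GroupLieAlgebra I G)) : E →L[ℝ] ℝ :=
  LinearMap.toContinuousLinearMap (show E →ₗ[ℝ] ℝ from α)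

variable [LieGroup I ∞ G] [I.Boundaryless]

theorem isCostate_iff_isAdjointCurve
    (hf : ∀ k, ContMDiffOn (I.prod 𝓘(ℝ, ℝ)) 𝓘(ℝ, E) 1 (fun p : G × ℝ => modeCoord f k p.1 p.2)
      (univ ×ˢ Icc t₀ t₁)) :
    IsCostate f t₀ t₁ L φ T g ρ ↔
      IsAdjointCurve (deviationLinearization t₀ t₁ (leftModeDeriv f g) (rightModeDeriv f g) T)
        (fun s => leftDerivCoord I L (g s)) t₀ t₁ (range (times t₀ t₁ T))
        (fun s => dualCoord (ρ s)) ∧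
      dualCoord (ρ t₁) = leftDerivCoord I φ (g t₁) := by
  have hode : ∀ s ∈ Icc t₀ t₁, ∀ η : GroupLieAlgebra I G,
      (-(dualCoord (ρ s) ∘L
        deviationLinearization t₀ t₁ (leftModeDeriv f g) (rightModeDeriv f g) T s)
        - leftDerivCoord I L (g s)) (η : E)
      = -ρ s (leftDerivLie (fun a => switchedField f t₀ t₁ T a s) (g s) η
          - ⁅switchedField f t₀ t₁ T (g s) s, η⁆) - leftDeriv I L (g s) η := fun s hs η =>
    congrArg (fun ζ : E => -dualCoord (ρ s) ζ - leftDerivCoord I L (g s) η)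
      (deviationLinearization_apply hf T hs η)
  refine ⟨fun h => ⟨⟨continuousOn_clm_apply.2 h.continuousOn, fun s hs hsT =>
    hasDerivAt_clm_apply.2 fun η => ?_⟩, ContinuousLinearMap.ext h.terminal⟩,
    fun h => ⟨fun η => DFunLike.congr_fun h.2 (η : E), continuousOn_clm_apply.1 h.1.continuousOn,
      fun s hs hsT η => ?_⟩⟩
  · have hs' := Ioo_subset_Icc_self hs
    exact (hode s hs' η).symm ▸ h.ode s hs' hsT η
  · exact hode s hs η ▸ hasDerivAt_clm_apply.1
      (h.1.hasDerivAt s (mem_Ioo_of_notMem_range_times hs hsT) hsT) η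

theorem exists_isCostate
    (hf : ∀ k, ContMDiffOn (I.prod 𝓘(ℝ, ℝ)) 𝓘(ℝ, E) 1 (fun p : G × ℝ => modeCoord f k p.1 p.2)
      (univ ×ˢ Icc t₀ t₁)) (h01 : t₀ ≤ t₁)
    (hsys : IsDeviationSystem t₀ t₁ r (leftMode f g) (rightMode f g) (leftModeDeriv f g)
      (rightModeDeriv f g))
    (hL : ContinuousOn (fun s => leftDerivCoord I L (g s)) (Icc t₀ t₁)) (φ : G → ℝ)
    (T : Fin n → ℝ) : ∃ ρ, IsCostate f t₀ t₁ L φ T g ρ := by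
  obtain ⟨p, hp, hp₁⟩ := hsys.exists_isAdjointCurve h01 hL T (leftDerivCoord I φ (g t₁))
  exact ⟨fun s => (p s : E →ₗ[ℝ] ℝ), (isCostate_iff_isAdjointCurve hf).2 ⟨hp, hp₁⟩⟩

theorem IsCostate.hasFDerivWithinAt_cost [T2Space G]
    (hf : ∀ k, ContMDiffOn (I.prod 𝓘(ℝ, ℝ)) 𝓘(ℝ, E) 1 (fun p : G × ℝ => modeCoord f k p.1 p.2)
      (univ ×ˢ Icc t₀ t₁)) (hT : T ∈ admissible n t₀ t₁)
    (hsys : IsDeviationSystem t₀ t₁ r (leftMode f g) (rightMode f g) (leftModeDeriv f g)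
      (rightModeDeriv f g)) (hr : closedBall 0 r ⊆ locTarget I G)
    (hL : UniformC1 t₀ t₁ r (fun t x => L (g t * locExp I G x))
      (fun t => leftDerivCoord I L (g t)))
    (hφ : MDifferentiableAt I 𝓘(ℝ, ℝ) φ (g t₁)) (hg : IsTrajectory f t₀ t₁ g₀ T g)
    (hρ : IsCostate f t₀ t₁ L φ T g ρ) :
    HasFDerivWithinAt (cost f t₀ t₁ g₀ L φ)
      (∑ i : Fin n, (ρ (T i) (f i.castSucc (g (T i)) (T i) - f i.succ (g (T i)) (T i))) •
        (ContinuousLinearMap.proj i : (Fin n → ℝ) →L[ℝ] ℝ)) (admissible n t₀ t₁) T := by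
  have : CompleteSpace E := FiniteDimensional.complete ℝ E
  have : ProperSpace E := FiniteDimensional.proper ℝ E
  have h01 := le_of_mem_admissible hT
  obtain ⟨hp, hp₁⟩ := (isCostate_iff_isAdjointCurve hf).1 hρ
  have hcost : ∀ᶠ T' in 𝓝[admissible n t₀ t₁] T, ∃ x,
      IsCaratheodorySolution (deviationField t₀ t₁ (leftMode f g) (rightMode f g) T T') t₀ t₁ r x ∧
      cost f t₀ t₁ g₀ L φ T' = curveCost t₀ t₁ L φ fun t => g t * locExp I G (x t) := by
    filter_upwards [mem_nhdsWithin_of_mem_nhds (eventually_existsUnique_trajectory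
      (fun k => (hf k).continuousOn) h01 hsys hr hg)] with T' ⟨x, hx, hγ, huniq⟩
    exact ⟨x, hx, cost_eq_curveCost h01 hγ huniq⟩
  convert hsys.hasFDerivWithinAt_cost hT hL (hp₁ ▸ hasFDerivAt_comp_mul_locExp hφ) hp hcost
    using 4 with i
  rw [leftMode_zero, leftMode_zero, map_sub]
  rfl

end Costate

end LieSwitched

end

theorem lemma1
    {E : Type*} [NormedAddCommGroup E] [NormedSpace ℝ E] [FiniteDimensional ℝ E]
    {H : Type*} [TopologicalSpace H] (I : ModelWithCorners ℝ E H) [I.Boundaryless]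
    {G : Type*} [TopologicalSpace G] [ChartedSpace H G] [Group G] [LieGroup I ∞ G] [T2Space G]
    (n : ℕ) (t₀ t₁ : ℝ) (g₀ : G)
    (f : Fin (n + 1) → G → ℝ → GroupLieAlgebra I G)
    (hf : ∀ k, ContMDiffOn (I.prod 𝓘(ℝ, ℝ)) 𝓘(ℝ, E) 1 (M' := E)
      (fun p : G × ℝ => (f k p.1 p.2 : E)) (Set.univ ×ˢ Set.Icc t₀ t₁))
    (L φ : G → ℝ) (hL : ContMDiff I 𝓘(ℝ, ℝ) 1 L) (hφ : MDifferentiable I 𝓘(ℝ, ℝ) φ)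
    (T : Fin n → ℝ) (hT : T ∈ LieSwitched.admissible n t₀ t₁)
    (g : ℝ → G) (hg : LieSwitched.IsTrajectory f t₀ t₁ g₀ T g) :
    -- near `T`, trajectories exist and are unique, so that the objective is well defined
    (∀ᶠ T' in 𝓝[LieSwitched.admissible n t₀ t₁] T,
      ∃ γ : ℝ → G, LieSwitched.IsTrajectory f t₀ t₁ g₀ T' γ ∧
        ∀ γ' : ℝ → G, LieSwitched.IsTrajectory f t₀ t₁ g₀ T' γ' →
          Set.EqOn γ' γ (Set.Icc t₀ t₁)) ∧
    -- the costate exists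
    (∃ ρ : ℝ → Module.Dual ℝ (GroupLieAlgebra I G),
      LieSwitched.IsCostate f t₀ t₁ L φ T g ρ) ∧
    ∀ ρ : ℝ → Module.Dual ℝ (GroupLieAlgebra I G),
      LieSwitched.IsCostate f t₀ t₁ L φ T g ρ →
      -- the gradient of the objective on the set of admissible transition times
      HasFDerivWithinAt (LieSwitched.cost f t₀ t₁ g₀ L φ)
        (∑ i : Fin n, (ρ (T i) (f i.castSucc (g (T i)) (T i) - f i.succ (g (T i)) (T i))) •
          (ContinuousLinearMap.proj i : (Fin n → ℝ) →L[ℝ] ℝ))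
        (LieSwitched.admissible n t₀ t₁) T ∧
      -- its components, the derivatives with respect to the single transition times
      ∀ i : Fin n,
        HasDerivWithinAt (fun s => LieSwitched.cost f t₀ t₁ g₀ L φ (Function.update T i s))
          (ρ (T i) (f i.castSucc (g (T i)) (T i) - f i.succ (g (T i)) (T i)))
          {s | Function.update T i s ∈ LieSwitched.admissible n t₀ t₁} (T i) := by
  have : CompleteSpace E := FiniteDimensional.complete ℝ E
  have : ProperSpace E := FiniteDimensional.proper ℝ E
  have h01 := LieSwitched.le_of_mem_admissible hT
  obtain ⟨r, hr, hsys, hℓ⟩ := LieSwitched.exists_isDeviationSystem hf hL hg.continuousOn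
  refine ⟨?_, LieSwitched.exists_isCostate hf h01 hsys hℓ.continuousOn_deriv φ T, fun ρ hρ => ?_⟩
  · have hunique := LieSwitched.eventually_existsUnique_trajectory (fun k => (hf k).continuousOn)
      h01 hsys hr hg
    filter_upwards [mem_nhdsWithin_of_mem_nhds hunique] with T' ⟨x, _, hγ, hγ'⟩
    exact ⟨_, hγ, hγ'⟩
  · have hgrad := hρ.hasFDerivWithinAt_cost hf hT hsys hr hℓ (hφ (g t₁)) hg
    refine ⟨hgrad, fun i => ?_⟩
    simpa [Pi.single_apply] using LieSwitched.hasDerivWithinAt_comp_update hgrad i
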